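/- Let $c>0$ and $\lambda>0$. A (Goldstein-Kac) telegraph process $X(t)$, $t\ge 0$, with parameters $(c,\lambda)$ is the position of a particle that starts at the origin of $\mathbb R$ at time $0$, takes the positive or the negative direction with probability $1/2$ each, moves with constant speed $c$, and reverses its direction at every event of a homogeneous Poisson process of rate $\lambda$ that is independent of the initial direction. Thus $X(t)=c\,D\int_0^t(-1)^{N(s)}\,ds$, where $\Pr\{D=1\}=\Pr\{D=-1\}=1/2$ and $N$ is a Poisson process of rate $\lambda$ independent of $D$. Let $X_1$ and $X_2$ be two independent telegraph processes with the same parameters $(c,\lambda)$, let $S(t)=X_1(t)+X_2(t)$, and let $\Phi(x,t)=\Pr\{S(t)<x\}$. Then for all $t>0$ and $x\in\mathbb R$ $$\Phi(x,t)=\begin{cases}0, & x\in(-\infty,-2ct],\\ G^-(x,t), & x\in(-2ct,0],\\ G^+(x,t), & x\in(0,2ct],\\ 1, & x\in(2ct,+\infty),\end{cases}$$ where $$G^{\pm}(x,t)=\frac12\pm\frac{e^{-2\lambda t}}{4}\cos\Bigl(\frac{\lambda x}{c}\Bigr)+\frac{\lambda x\,e^{-2\lambda t}}{2c}\Biggl[\sum_{k=0}^\infty\frac{(\lambda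 t)^{2k}}{(k!)^2}\Bigl(1+\frac{\lambda t}{2k+2}\Bigr)F\Bigl(-k,\frac12;\frac32;\frac{x^2}{4c^2t^2}\Bigr)+\sum_{k=0}^\infty\frac{(\lambda t)^{2k+1}}{(k!)^2(2k+1)}\;{}_3F_2\Bigl(-k,-k-\frac12,\frac12;-k+\frac12,\frac32;\frac{x^2}{4c^2t^2}\Bigr)\Biggr],$$ and both series converge for $x\in(-2ct,2ct]$. Here, with $(a)_0=1$ and $(a)_n=a(a+1)\cdots(a+n-1)$, $$F(\alpha,\beta;\gamma;z)=\sum_{n=0}^\infty\frac{(\alpha)_n(\beta)_n}{(\gamma)_n}\frac{z^n}{n!},\qquad {}_3F_2(\alpha,\beta,\gamma;\xi,\zeta;z)=\sum_{n=0}^\infty\frac{(\alpha)_n(\beta)_n(\gamma)_n}{(\xi)_n(\zeta)_n}\frac{z^n}{n!}.$$ -/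

import Mathlib

open MeasureTheory ProbabilityTheory Set
open scoped NNReal

noncomputable section

/-- A homogeneous Poisson process of rate `lam`: an `ℕ`-valued process starting from `0`, with
independent increments, with `N t - N s` Poisson distributed with parameter `lam * (t - s)` for
`s ≤ t`, and almost surely with nondecreasing right-continuous paths. -/
structure IsPoissonProcess {Ω : Type*} [MeasurableSpace Ω] (lam : ℝ≥0) (N : ℝ≥0 → Ω → ℕ)
    (P : Measure Ω) : Prop where
  measurable : ∀ t, Measurable (N t)
  start : ∀ᵐ ω ∂P, N 0 ω = 0
  indepIncrements : HasIndepIncrements N P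
  increments_law : ∀ s t : ℝ≥0, s ≤ t →
    HasLaw (fun ω => N t ω - N s ω) (poissonMeasure (lam * (t - s))) P
  monotone_paths : ∀ᵐ ω ∂P, Monotone fun t => N t ω
  rightContinuous_paths : ∀ᵐ ω ∂P, ∀ t, ContinuousWithinAt (fun s => N s ω) (Ioi t) t

/-- The position at time `t` of a particle starting at `0` with initial velocity `d * c` whose
velocity changes sign at every jump of the counting path `n`: the integral over `[0, t]` of the
velocity `d * c * (-1) ^ n s`. -/
def telegraphPosition (c d : ℝ) (n : ℝ≥0 → ℕ) (t : ℝ≥0) : ℝ :=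
  ∫ s in (0 : ℝ)..t, d * c * (-1) ^ n s.toNNReal

/-- `X` is a Goldstein-Kac telegraph process with speed `c` and switching rate `lam`, started from
the origin: the initial direction `D` is `1` or `-1` with probability `1 / 2` each, and
the direction is reversed at each event of a Poisson process `N` of rate `lam` which is
independent of `D`. -/
def IsTelegraphProcess {Ω : Type*} [MeasurableSpace Ω] (c : ℝ) (lam : ℝ≥0) (X : ℝ≥0 → Ω → ℝ)
    (P : Measure Ω) : Prop :=
  ∃ (D : Ω → ℝ) (N : ℝ≥0 → Ω → ℕ),
    Measurable D ∧ P {ω | D ω = 1} = 1 / 2 ∧ P {ω | D ω = -1} = 1 / 2 ∧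
    IsPoissonProcess lam N P ∧
    IndepFun D (fun ω t => N t ω) P ∧
    ∀ᵐ ω ∂P, ∀ t, X t ω = telegraphPosition c (D ω) (fun s => N s ω) t

/-- The rising factorial `(a)_n = a (a + 1) ⋯ (a + n - 1)`. -/
def risingFactorial (a : ℝ) (n : ℕ) : ℝ := (ascPochhammer ℝ n).eval a

/-- The generalized hypergeometric function `₃F₂(a₁, a₂, a₃; b₁, b₂; z)`. -/
def hypergeometric32 (a₁ a₂ a₃ b₁ b₂ z : ℝ) : ℝ :=
  ∑' n : ℕ, risingFactorial a₁ n * risingFactorial a₂ n * risingFactorial a₃ n /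
    (risingFactorial b₁ n * risingFactorial b₂ n) * (z ^ n / n.factorial)

/-- The `k`-th term of the first series, containing the Gauss hypergeometric function. -/
def gaussTerm (c lam x t : ℝ) (k : ℕ) : ℝ :=
  (lam * t) ^ (2 * k) / (k.factorial : ℝ) ^ 2 * (1 + lam * t / (2 * k + 2)) *
    ordinaryHypergeometric (-(k : ℝ)) (1 / 2 : ℝ) (3 / 2 : ℝ) (x ^ 2 / (4 * c ^ 2 * t ^ 2))

/-- The `k`-th term of the second series, containing the function `₃F₂`. -/
def threeTwoTerm (c lam x t : ℝ) (k : ℕ) : ℝ :=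
  (lam * t) ^ (2 * k + 1) / ((k.factorial : ℝ) ^ 2 * (2 * k + 1)) *
    hypergeometric32 (-(k : ℝ)) (-(k : ℝ) - 1 / 2) (1 / 2) (-(k : ℝ) + 1 / 2) (3 / 2)
      (x ^ 2 / (4 * c ^ 2 * t ^ 2))

/-- The functions `G⁺` (for `ε = 1`) and `G⁻` (for `ε = -1`). -/
def telegraphSumG (ε c lam x t : ℝ) : ℝ :=
  1 / 2 + ε * (Real.exp (-2 * lam * t) / 4) * Real.cos (lam * x / c) +
    lam * x * Real.exp (-2 * lam * t) / (2 * c) *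
      ((∑' k, gaussTerm c lam x t k) + ∑' k, threeTwoTerm c lam x t k)

end

open Filter Topology

/-! The law of the sum is identified by its characteristic function. Write σ = (-1)^N and let Y be
the integral of σ. Calculus along paths gives f(t) = E cos(aY_t) in terms of g(t) = E[σ_t
sin(aY_t)]. Since N_T - N_s is independent of the past and E(-1)^(N_T - N_s) = exp(-2λ(T-s)), g is
in turn an integral of f. Together, f' = -a g and g' = a f - 2λ g, so f is exp(-λt) times a
combination of cosh and sinh of t√(λ² - a²), written through `hypSeries` to avoid a case split on
the sign of λ² - a² (`IsPoissonProcess.integral_cos_displacement_eq`). As the initial direction is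
symmetric, f at a = αc is the characteristic function of X(t), and independence squares it.

Put L = λt and z = x/(2ct). Duplication formulas turn the square into a linear combination of
`hypSeries 0`, `hypSeries 1`, `hypSeries 2` at 4L² - β² (`sq_hypSeries_add`). Expanding in powers of
4L² and -β², the coefficient of each power of L is the cosine transform of an explicit polynomial on
[0, 1]: a multiple of (1-z²)^k for `hypSeries 1` and for `hypSeries 0` minus cos β, a multiple of ∫
s in z..1, (s²-z²)^k for `hypSeries 2`. Hence the explicit measure `telegraphSumLaw`, with atoms at
0 and ±1 (no reversal of either particle) and a series of polynomial densities, has the right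
characteristic function (`map_telegraph_sum_eq`).

The distribution function follows by termwise integration (`hasSum_integral_telegraphSumDensity`):
the antiderivatives are z times the terminating F and ₃F₂, except that the odd powers in the second
family sum to (1 - cos 2Lz)/4. Half of the atom at 0, of weight 1/4, cancels the constant and leaves
the cosine of G. -/

/-! ### Calculus along a single counting path -/

/-- The velocity sign `(-1) ^ n s` of a counting path, as a function of real time. -/
noncomputable def signPath (n : ℝ≥0 → ℕ) (s : ℝ) : ℝ := (-1) ^ n s.toNNReal

/-- The integral over `[0, t]` of the velocity sign of a counting path. -/
noncomputable def displacement (n : ℝ≥0 → ℕ) (t : ℝ) : ℝ := ∫ s in (0 : ℝ)..t, signPath n s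

/-- Counting paths: nondecreasing, right-continuous, starting from `0`. -/
structure IsCountingPath (n : ℝ≥0 → ℕ) : Prop where
  start : n 0 = 0
  mono : Monotone n
  rightCts : ∀ t, ContinuousWithinAt n (Ioi t) t

lemma abs_signPath (n : ℝ≥0 → ℕ) (s : ℝ) : |signPath n s| = 1 := by
  simp [signPath, abs_pow]

lemma telegraphPosition_eq (c d : ℝ) (n : ℝ≥0 → ℕ) (t : ℝ≥0) :
    telegraphPosition c d n t = d * c * displacement n t := by
  simp only [telegraphPosition, displacement, signPath]
  rw [intervalIntegral.integral_const_mul]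

namespace IsCountingPath

variable {n : ℝ≥0 → ℕ}

lemma tendsto_toNNReal (h : IsCountingPath n) (s : ℝ) :
    Tendsto (fun u : ℝ => n u.toNNReal) (𝓝[≥] s) (pure (n s.toNNReal)) := by
  have h1 : ContinuousWithinAt n (Ici s.toNNReal) s.toNNReal :=
    continuousWithinAt_Ioi_iff_Ici.1 (h.rightCts _)
  have h2 : Tendsto Real.toNNReal (𝓝[≥] s) (𝓝[≥] s.toNNReal) :=
    (continuous_real_toNNReal.continuousWithinAt (s := Ici s) (x := s)).tendsto_nhdsWithin
      (fun u hu => Real.toNNReal_le_toNNReal hu)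
  have h3 := h1.tendsto.comp h2
  rwa [nhds_discrete] at h3

lemma measurable_signPath (h : IsCountingPath n) : Measurable (signPath n) := by
  have h1 : Measurable (fun s : ℝ => n s.toNNReal) :=
    Monotone.measurable fun a b hab => h.mono (Real.toNNReal_le_toNNReal hab)
  exact (Measurable.of_discrete (f := fun k : ℕ => (-1 : ℝ) ^ k)).comp h1

lemma continuousWithinAt_signPath (h : IsCountingPath n) (s : ℝ) :
    ContinuousWithinAt (signPath n) (Ici s) s := by
  have := h.tendsto_toNNReal s
  rw [tendsto_pure] at this
  refine tendsto_const_nhds.congr' (f₁ := fun _ => signPath n s) ?_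
  filter_upwards [this] with u hu
  simp [signPath, hu]

lemma intervalIntegrable_mul (h : IsCountingPath n) {φ : ℝ → ℝ} (hφ : Continuous φ) (a b : ℝ) :
    IntervalIntegrable (fun s => signPath n s * φ s) volume a b := by
  refine (hφ.intervalIntegrable a b).mono_fun
    (h.measurable_signPath.mul hφ.measurable).aestronglyMeasurable (ae_of_all _ fun s => ?_)
  simp [abs_signPath]

lemma intervalIntegrable (h : IsCountingPath n) (a b : ℝ) :
    IntervalIntegrable (signPath n) volume a b := by
  simpa using h.intervalIntegrable_mul (φ := fun _ => 1) continuous_const a b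

lemma continuous_displacement (h : IsCountingPath n) : Continuous (displacement n) :=
  intervalIntegral.continuous_primitive (fun a b => h.intervalIntegrable a b) 0

/-- Only a right derivative exists at a jump time; with continuity it suffices for the fundamental
theorem of calculus used for cos and sin below. -/
lemma hasDerivWithinAt_displacement (h : IsCountingPath n) (s : ℝ) :
    HasDerivWithinAt (displacement n) (signPath n s) (Ioi s) s := by
  refine (intervalIntegral.integral_hasDerivWithinAt_right (h.intervalIntegrable 0 s)
    (t := Ioi s) (s := Ici s) ?_
    ((h.continuousWithinAt_signPath s).mono Ioi_subset_Ici_self)).mono Ioi_subset_Ici_self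
  exact h.measurable_signPath.stronglyMeasurable.stronglyMeasurableAtFilter

lemma cos_displacement (h : IsCountingPath n) (a t : ℝ) :
    Real.cos (a * displacement n t) =
      1 - a * ∫ s in (0 : ℝ)..t, signPath n s * Real.sin (a * displacement n s) := by
  have hc := h.continuous_displacement
  have := intervalIntegral.integral_eq_sub_of_hasDeriv_right (a := 0) (b := t)
    (f := fun s => Real.cos (a * displacement n s))
    (f' := fun s => -a * (signPath n s * Real.sin (a * displacement n s)))
    (by fun_prop) (fun s _ => by
      convert! ((h.hasDerivWithinAt_displacement s).const_mul a).cos using 1; ring)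
    ((h.intervalIntegrable_mul (by fun_prop) 0 t).const_mul _)
  rw [intervalIntegral.integral_const_mul] at this
  simp [displacement] at this ⊢
  linarith

lemma sin_displacement (h : IsCountingPath n) (a t : ℝ) :
    Real.sin (a * displacement n t) =
      a * ∫ s in (0 : ℝ)..t, signPath n s * Real.cos (a * displacement n s) := by
  have hc := h.continuous_displacement
  have := intervalIntegral.integral_eq_sub_of_hasDeriv_right (a := 0) (b := t)
    (f := fun s => Real.sin (a * displacement n s))
    (f' := fun s => a * (signPath n s * Real.cos (a * displacement n s)))
    (by fun_prop) (fun s _ => by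
      convert! ((h.hasDerivWithinAt_displacement s).const_mul a).sin using 1; ring)
    ((h.intervalIntegrable_mul (by fun_prop) 0 t).const_mul _)
  rw [intervalIntegral.integral_const_mul] at this
  simp [displacement] at this ⊢
  linarith

end IsCountingPath

/-! ### Riemann sums and measurability -/

/-- The right endpoint of the grid cell containing `u` approaches `u` from the right, the only side
on which counting paths are continuous. -/
lemma tendsto_ceil_mul_div {s : ℝ} (hs : 0 < s) {u : ℝ} (hu : 0 ≤ u) :
    Tendsto (fun k : ℕ => s * ⌈u * k / s⌉₊ / k) atTop (𝓝[≥] u) := by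
  refine tendsto_nhdsWithin_iff.2 ⟨?_, ?_⟩
  · refine tendsto_of_tendsto_of_tendsto_of_le_of_le' (g := fun _ => u)
      (h := fun k : ℕ => u + s / k) tendsto_const_nhds ?_ ?_ ?_
    · simpa using tendsto_const_nhds.add (tendsto_const_div_atTop_nhds_zero_nat s)
    · filter_upwards [eventually_gt_atTop 0] with k hk
      have hk' : (0 : ℝ) < k := by exact_mod_cast hk
      have := Nat.le_ceil (u * k / s)
      rw [le_div_iff₀ hk']
      rw [div_le_iff₀ hs] at this
      linarith
    · filter_upwards [eventually_gt_atTop 0] with k hk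
      have hk' : (0 : ℝ) < k := by exact_mod_cast hk
      have := (Nat.ceil_lt_add_one (a := u * k / s) (by positivity)).le
      rw [div_le_iff₀ hk', add_mul, div_mul_cancel₀ _ hk'.ne']
      calc s * (⌈u * k / s⌉₊ : ℝ) ≤ s * (u * k / s + 1) := by gcongr
        _ = u * k + s := by field_simp
  · filter_upwards [eventually_gt_atTop 0] with k hk
    have hk' : (0 : ℝ) < k := by exact_mod_cast hk
    have := Nat.le_ceil (u * k / s)
    rw [mem_Ici, le_div_iff₀ hk']
    rw [div_le_iff₀ hs] at this
    linarith

lemma IsCountingPath.tendsto_riemannSum {n : ℝ≥0 → ℕ} (h : IsCountingPath n) {s : ℝ} (hs : 0 < s) :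
    Tendsto (fun k : ℕ => ∑ j ∈ Finset.range k, s / k * signPath n (s * (j + 1 : ℕ) / k)) atTop
      (𝓝 (displacement n s)) := by
  -- The Riemann sum is the integral of the path sampled at right endpoints, so dominated
  -- convergence with bound 1 applies.
  have key : Tendsto (fun k : ℕ => ∫ u in (0 : ℝ)..s, signPath n (s * ⌈u * k / s⌉₊ / k)) atTop
      (𝓝 (∫ u in (0 : ℝ)..s, signPath n u)) := by
    refine intervalIntegral.tendsto_integral_filter_of_dominated_convergence (fun _ => 1)
      (Eventually.of_forall fun k => ?_) (Eventually.of_forall fun k => ae_of_all _ fun u _ => ?_)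
      intervalIntegrable_const (ae_of_all _ fun u hu => ?_)
    · refine (h.measurable_signPath.comp ?_).aestronglyMeasurable
      have : Measurable (fun u : ℝ => (⌈u * k / s⌉₊ : ℝ)) :=
        (Measurable.of_discrete (f := fun k : ℕ => (k : ℝ))).comp
          (Nat.measurable_ceil.comp (by fun_prop))
      fun_prop
    · simp [abs_signPath]
    · rw [uIoc_of_le hs.le] at hu
      exact (h.continuousWithinAt_signPath u).tendsto.comp (tendsto_ceil_mul_div hs hu.1.le)
  refine key.congr' ?_
  filter_upwards [eventually_gt_atTop 0] with k hk
  have hk' : (0 : ℝ) < k := by exact_mod_cast hk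
  have hc : ∀ j : ℕ, EqOn (fun u : ℝ => signPath n (s * ⌈u * k / s⌉₊ / k))
      (fun _ => signPath n (s * (j + 1 : ℕ) / k)) (uIoc (s * j / k) (s * (j + 1 : ℕ) / k)) := by
    intro j u hu
    rw [uIoc_of_le (by gcongr; simp)] at hu
    have : ⌈u * k / s⌉₊ = j + 1 := by
      rw [Nat.ceil_eq_iff (by simp)]
      obtain ⟨h1, h2⟩ := hu
      rw [div_lt_iff₀ hk'] at h1
      rw [le_div_iff₀ hk'] at h2
      rw [lt_div_iff₀ hs, div_le_iff₀ hs]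
      simp only [Nat.add_sub_cancel]
      constructor <;> linarith
    simp only [this]
  have := intervalIntegral.sum_integral_adjacent_intervals (n := k) (μ := volume)
    (f := fun u : ℝ => signPath n (s * ⌈u * k / s⌉₊ / k)) (a := fun j : ℕ => s * j / k)
    (fun j _ => (intervalIntegrable_congr (hc j)).2 intervalIntegrable_const)
  simp only [Nat.cast_zero, mul_zero, zero_div, mul_div_cancel_right₀ s hk'.ne'] at this
  rw [← this]
  refine Finset.sum_congr rfl fun j _ => ?_
  rw [intervalIntegral.integral_congr_ae (g := fun _ => signPath n (s * (j + 1 : ℕ) / k))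
    (ae_of_all _ fun u hu => hc j hu)]
  rw [intervalIntegral.integral_const, smul_eq_mul]
  push_cast
  ring_nf

section

variable {Ω : Type*} [MeasurableSpace Ω]

lemma measurable_uncurry_signPath {N : ℝ≥0 → Ω → ℕ} (hm : ∀ t, Measurable (N t))
    (hN : ∀ ω, IsCountingPath fun t => N t ω) :
    Measurable (fun p : ℝ × Ω => signPath (fun t => N t p.2) p.1) := by
  -- `Real.toNNReal` truncates at 0, so time may be replaced by its positive part, where the grid
  -- approximation is valid.
  have h0 : (fun p : ℝ × Ω => signPath (fun t => N t p.2) p.1)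
      = fun p => signPath (fun t => N t p.2) (max p.1 0) := by
    funext p
    have : p.1.toNNReal = (max p.1 0).toNNReal := by
      ext; simp
    simp only [signPath, this]
  rw [h0]
  refine measurable_of_tendsto_metrizable (f := fun (k : ℕ) (p : ℝ × Ω) =>
    signPath (fun t => N t p.2) (1 * ⌈max p.1 0 * k / 1⌉₊ / k)) (fun k => ?_) ?_
  · have h1 : Measurable (fun q : ℕ × Ω => signPath (fun t => N t q.2) (1 * q.1 / k)) := by
      refine measurable_from_prod_countable_right fun j => ?_
      have := hm (1 * (j : ℝ) / k).toNNReal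
      exact (Measurable.of_discrete (f := fun k : ℕ => (-1 : ℝ) ^ k)).comp this
    have h2 : Measurable (fun p : ℝ × Ω => ⌈max p.1 0 * k / 1⌉₊) :=
      Nat.measurable_ceil.comp (by fun_prop)
    have h3 := h1.comp (h2.prodMk measurable_snd)
    simp only [Function.comp_def] at h3
    exact h3
  · rw [tendsto_pi_nhds]
    intro p
    exact ((hN p.2).continuousWithinAt_signPath _).tendsto.comp
      (tendsto_ceil_mul_div one_pos (le_max_right _ _))

lemma measurable_displacement {N : ℝ≥0 → Ω → ℕ} (hm : ∀ t, Measurable (N t))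
    (hN : ∀ ω, IsCountingPath fun t => N t ω) (t : ℝ) :
    Measurable (fun ω => displacement (fun s => N s ω) t) := by
  have h := (measurable_uncurry_signPath hm hN).stronglyMeasurable
  simp only [displacement, intervalIntegral]
  exact ((h.integral_prod_left' (μ := volume.restrict (Ioc 0 t))).sub
    (h.integral_prod_left' (μ := volume.restrict (Ioc t 0)))).measurable

lemma measurable_uncurry_displacement {N : ℝ≥0 → Ω → ℕ} (hm : ∀ t, Measurable (N t))
    (hN : ∀ ω, IsCountingPath fun t => N t ω) :
    Measurable (fun p : ℝ × Ω => displacement (fun t => N t p.2) p.1) :=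
  measurable_uncurry_of_continuous_of_measurable
    (u := fun (t : ℝ) ω => displacement (fun s => N s ω) t)
    (fun ω => (hN ω).continuous_displacement) (measurable_displacement hm hN)

end

/-! ### Expectations over the Poisson process -/

section

variable {Ω : Type*} [MeasurableSpace Ω]

/-- Resetting the process to 0 on a measurable null set containing all bad paths makes every path
regular, as the joint measurability lemmas require. -/
lemma IsPoissonProcess.exists_countingPath_version {P : Measure Ω} {lam : ℝ≥0} {N : ℝ≥0 → Ω → ℕ}
    (h : IsPoissonProcess lam N P) :
    ∃ N' : ℝ≥0 → Ω → ℕ, IsPoissonProcess lam N' P ∧ (∀ ω, IsCountingPath fun t => N' t ω) ∧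
      ∀ᵐ ω ∂P, ∀ t, N' t ω = N t ω := by
  classical
  have hae : ∀ᵐ ω ∂P, IsCountingPath fun t => N t ω := by
    filter_upwards [h.start, h.monotone_paths, h.rightContinuous_paths] with ω h1 h2 h3
    exact ⟨h1, h2, h3⟩
  obtain ⟨A, hbad, hA, hA0⟩ := exists_measurable_superset_of_null (ae_iff.1 hae)
  have hagree : ∀ᵐ ω ∂P, ∀ t, (if ω ∈ A then 0 else N t ω) = N t ω := by
    filter_upwards [measure_eq_zero_iff_ae_notMem.1 hA0] with ω hω t
    simp [hω]
  have hpath : ∀ ω, IsCountingPath fun t => if ω ∈ A then 0 else N t ω := by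
    intro ω
    by_cases hω : ω ∈ A
    · simp only [hω, if_true]
      exact ⟨rfl, monotone_const, fun t => continuousWithinAt_const⟩
    · simp only [hω, if_false]
      by_contra hc
      exact hω (hbad hc)
  refine ⟨fun t ω => if ω ∈ A then 0 else N t ω, ?_, hpath, hagree⟩
  refine ⟨fun t => Measurable.ite hA measurable_const (h.measurable t),
    ae_of_all _ fun ω => (hpath ω).start, fun k t ht => ?_, fun s t hst => ?_,
    ae_of_all _ fun ω => (hpath ω).mono, ae_of_all _ fun ω => (hpath ω).rightCts⟩
  · refine (h.indepIncrements k t ht).congr fun i => ?_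
    filter_upwards [hagree] with ω hω
    simp only [hω]
  · refine (h.increments_law s t hst).congr ?_
    filter_upwards [hagree] with ω hω
    simp only [hω]

lemma integral_neg_one_pow_poissonMeasure (r : ℝ≥0) :
    ∫ n, (-1 : ℝ) ^ n ∂(poissonMeasure r) = Real.exp (-2 * r) := by
  rw [integral_poissonMeasure]
  have h : ∀ n : ℕ, (Real.exp (-r) * r ^ n / n.factorial) • (-1 : ℝ) ^ n
      = Real.exp (-r) * ((-r : ℝ) ^ n / n.factorial) := by
    intro n; rw [neg_pow (r : ℝ), smul_eq_mul]; ring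
  simp_rw [h]
  rw [tsum_mul_left]
  have h2 : ∑' n : ℕ, (-r : ℝ) ^ n / n.factorial = Real.exp (-r) := by
    rw [Real.exp_eq_exp_ℝ, NormedSpace.exp_eq_tsum_div]
  rw [h2, ← Real.exp_add]
  congr 1; ring

namespace IsPoissonProcess

variable {P : Measure Ω} {lam : ℝ≥0} {N : ℝ≥0 → Ω → ℕ}

lemma integral_neg_one_pow_sub (h : IsPoissonProcess lam N P) {s T : ℝ} (hs : 0 ≤ s) (hsT : s ≤ T) :
    ∫ ω, (-1 : ℝ) ^ (N T.toNNReal ω - N s.toNNReal ω) ∂P = Real.exp (-2 * lam * (T - s)) := by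
  have hle := Real.toNNReal_le_toNNReal hsT
  have hl := h.increments_law _ _ hle
  have hi := hl.integral_comp (f := fun n : ℕ => (-1 : ℝ) ^ n)
    Measurable.of_discrete.aestronglyMeasurable
  simp only [Function.comp_def] at hi
  rw [hi, integral_neg_one_pow_poissonMeasure]
  congr 1
  rw [NNReal.coe_mul, NNReal.coe_sub hle, Real.coe_toNNReal _ hs,
    Real.coe_toNNReal _ (hs.trans hsT)]
  ring

/-- A Riemann sum over `[0, s]` depends only on the increments between grid points, and these are
independent of the increment from `s` to `T`. -/
lemma integral_mul_cos_riemannSum (h : IsPoissonProcess lam N P)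
    (hN : ∀ ω, IsCountingPath fun t => N t ω) {s T : ℝ} (hs : 0 ≤ s) (hsT : s ≤ T) (a : ℝ)
    {k : ℕ} (hk : 0 < k) :
    ∫ ω, (-1 : ℝ) ^ (N T.toNNReal ω - N s.toNNReal ω) * Real.cos (a *
        ∑ j ∈ Finset.range k, s / k * signPath (fun t => N t ω) (s * (j + 1 : ℕ) / k)) ∂P
      = (∫ ω, (-1 : ℝ) ^ (N T.toNNReal ω - N s.toNNReal ω) ∂P) * ∫ ω, Real.cos (a *
        ∑ j ∈ Finset.range k, s / k * signPath (fun t => N t ω) (s * (j + 1 : ℕ) / k)) ∂P := by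
  have hk' : (0 : ℝ) < k := by exact_mod_cast hk
  -- The grid of `[0, s]` followed by the constant `T`: increments 0, ..., k-1 describe the past and
  -- increment `k` runs from `s` to `T`.
  let τ : ℕ → ℝ≥0 := fun i => if i ≤ k then (s * i / k).toNNReal else T.toNNReal
  have hτ : Monotone τ := by
    intro i j hij
    by_cases hj : j ≤ k
    · have hi : i ≤ k := hij.trans hj
      simp only [τ, hi, hj, if_true]
      exact Real.toNNReal_le_toNNReal (by gcongr)
    · by_cases hi : i ≤ k
      · simp only [τ, hi, hj, if_true, if_false]
        refine Real.toNNReal_le_toNNReal (le_trans ?_ hsT)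
        rw [div_le_iff₀ hk']
        have : (i : ℝ) ≤ k := by exact_mod_cast hi
        gcongr
      · simp [τ, hi, hj]
  have hτk : τ k = s.toNNReal := by simp [τ, hk'.ne']
  have hτk1 : τ (k + 1) = T.toNNReal := by simp [τ]
  have hind := h.indepIncrements.nat hτ
  have hdisj : Disjoint (Finset.range k) {k} := by simp
  have h2 := hind.indepFun_finset (Finset.range k) {k} hdisj
    (fun i => (h.measurable _).sub (h.measurable _))
  -- The value of `N` at a grid point is recovered by summing increments; the default 0 is never
  -- reached, since `i ≤ j < k`.
  let Ψ : (Finset.range k → ℕ) → ℝ := fun v => Real.cos (a * ∑ j ∈ Finset.range k, s / k *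
    (-1) ^ (∑ i ∈ Finset.range (j + 1), if hi : i ∈ Finset.range k then v ⟨i, hi⟩ else 0))
  let Z : (({k} : Finset ℕ) → ℕ) → ℝ := fun v => (-1) ^ v ⟨k, by simp⟩
  have h3 := h2.symm.comp (φ := Z) (ψ := Ψ) Measurable.of_discrete Measurable.of_discrete
  have h4 := h3.integral_fun_mul_eq_mul_integral
    (((Measurable.of_discrete (f := Z)).comp (measurable_pi_lambda _ fun i =>
      (h.measurable _).sub (h.measurable _))).aestronglyMeasurable)
    (((Measurable.of_discrete (f := Ψ)).comp (measurable_pi_lambda _ fun i =>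
      (h.measurable _).sub (h.measurable _))).aestronglyMeasurable)
  have hZ : ∀ ω, Z (fun i => N (τ (i + 1)) ω - N (τ i) ω)
      = (-1) ^ (N T.toNNReal ω - N s.toNNReal ω) := by
    intro ω; simp only [Z, hτk, hτk1]
  have hΨ : ∀ ω, Ψ (fun i => N (τ (i + 1)) ω - N (τ i) ω) = Real.cos (a *
        ∑ j ∈ Finset.range k, s / k * signPath (fun t => N t ω) (s * (j + 1 : ℕ) / k)) := by
    intro ω
    simp only [Ψ]
    congr 2
    refine Finset.sum_congr rfl fun j hj => ?_
    congr 1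
    have hj' := Finset.mem_range.1 hj
    have : ∑ i ∈ Finset.range (j + 1), (if hi : i ∈ Finset.range k then
        N (τ (i + 1)) ω - N (τ i) ω else 0) = N (τ (j + 1)) ω - N (τ 0) ω := by
      rw [← Finset.sum_range_tsub (f := fun i => N (τ i) ω)
        (fun i j hij => (hN ω).mono (hτ hij))]
      refine Finset.sum_congr rfl fun i hi => ?_
      rw [dif_pos]
      have := Finset.mem_range.1 hi
      simp; omega
    rw [this]
    have h0 : τ 0 = 0 := by simp [τ]
    have h1 : τ (j + 1) = (s * (j + 1 : ℕ) / k).toNNReal := by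
      simp only [τ]; rw [if_pos (by omega)]
    have := (hN ω).start
    rw [h0, h1, this, Nat.sub_zero, signPath]
  simp only [Function.comp_def, hZ, hΨ] at h4
  exact h4

variable [IsProbabilityMeasure P]

/-- The product of the signs at `s` and `T` is (-1)^(N_T - N_s); independence from the displacement
passes from Riemann sums to the limit. -/
lemma integral_sign_mul_cos (h : IsPoissonProcess lam N P)
    (hN : ∀ ω, IsCountingPath fun t => N t ω) {s T : ℝ} (hs : 0 ≤ s) (hsT : s ≤ T) (a : ℝ) :
    ∫ ω, signPath (fun t => N t ω) T * (signPath (fun t => N t ω) s *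
        Real.cos (a * displacement (fun t => N t ω) s)) ∂P
      = Real.exp (-2 * lam * (T - s)) * ∫ ω, Real.cos (a * displacement (fun t => N t ω) s) ∂P := by
  have hsign : ∀ ω, signPath (fun t => N t ω) T * (signPath (fun t => N t ω) s *
        Real.cos (a * displacement (fun t => N t ω) s)) =
        (-1 : ℝ) ^ (N T.toNNReal ω - N s.toNNReal ω) *
          Real.cos (a * displacement (fun t => N t ω) s) := by
    intro ω
    rw [← mul_assoc]
    congr 1
    have := (hN ω).mono (Real.toNNReal_le_toNNReal hsT)
    obtain ⟨d, hd⟩ := Nat.exists_eq_add_of_le this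
    simp only [signPath, hd, Nat.add_sub_cancel_left]
    rw [pow_add, mul_right_comm, ← pow_add, ← two_mul, pow_mul]; simp
  simp_rw [hsign]
  rw [← h.integral_neg_one_pow_sub hs hsT]
  rcases hs.eq_or_lt with rfl | hs'
  · simp [displacement]
  have hmeas : ∀ k : ℕ, Measurable fun ω => Real.cos (a * ∑ j ∈ Finset.range k, s / k *
      signPath (fun t => N t ω) (s * (j + 1 : ℕ) / k)) := by
    intro k
    refine Real.measurable_cos.comp (measurable_const.mul (Finset.measurable_sum _ fun j _ =>
      measurable_const.mul ?_))
    exact (Measurable.of_discrete (f := fun k : ℕ => (-1 : ℝ) ^ k)).comp (h.measurable _)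
  have hmZ : Measurable fun ω => (-1 : ℝ) ^ (N T.toNNReal ω - N s.toNNReal ω) :=
    (Measurable.of_discrete (f := fun k : ℕ => (-1 : ℝ) ^ k)).comp
      ((h.measurable _).sub (h.measurable _))
  have hlim : ∀ ω, Tendsto (fun k : ℕ => Real.cos (a * ∑ j ∈ Finset.range k, s / k *
      signPath (fun t => N t ω) (s * (j + 1 : ℕ) / k))) atTop
      (𝓝 (Real.cos (a * displacement (fun t => N t ω) s))) := fun ω =>
    (Real.continuous_cos.tendsto _).comp (((hN ω).tendsto_riemannSum hs').const_mul a)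
  have l1 := tendsto_integral_of_dominated_convergence (μ := P) (fun _ => (1 : ℝ))
    (fun k => (hmZ.mul (hmeas k)).aestronglyMeasurable) (integrable_const _)
    (fun k => ae_of_all _ fun ω => by simpa [abs_pow] using Real.abs_cos_le_one _)
    (ae_of_all _ fun ω => (hlim ω).const_mul _)
  have l2 := tendsto_integral_of_dominated_convergence (μ := P) (fun _ => (1 : ℝ))
    (fun k => (hmeas k).aestronglyMeasurable) (integrable_const _)
    (fun k => ae_of_all _ fun ω => by simpa using Real.abs_cos_le_one _)
    (ae_of_all _ hlim)
  refine tendsto_nhds_unique l1 ((l2.const_mul _).congr' ?_)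
  filter_upwards [eventually_gt_atTop 0] with k hk
  exact (h.integral_mul_cos_riemannSum hN hs hsT a hk).symm

lemma integral_cos_displacement (h : IsPoissonProcess lam N P)
    (hN : ∀ ω, IsCountingPath fun t => N t ω) (a t : ℝ) :
    ∫ ω, Real.cos (a * displacement (fun t => N t ω) t) ∂P = 1 - a * ∫ s in (0 : ℝ)..t,
      ∫ ω, signPath (fun t => N t ω) s * Real.sin (a * displacement (fun t => N t ω) s) ∂P := by
  have hm : Measurable (fun p : ℝ × Ω => signPath (fun t => N t p.2) p.1 *
      Real.sin (a * displacement (fun t => N t p.2) p.1)) :=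
    (measurable_uncurry_signPath h.measurable hN).mul
      (Real.measurable_sin.comp ((measurable_uncurry_displacement h.measurable hN).const_mul a))
  have : IsFiniteMeasure (volume.restrict (uIoc 0 t)) := by rw [uIoc]; infer_instance
  have hint : Integrable (Function.uncurry fun (s : ℝ) ω => signPath (fun t => N t ω) s *
      Real.sin (a * displacement (fun t => N t ω) s)) ((volume.restrict (uIoc 0 t)).prod P) := by
    refine (integrable_const (1 : ℝ)).mono' hm.aestronglyMeasurable (ae_of_all _ fun p => ?_)
    simpa [Function.uncurry, abs_mul, abs_signPath] using Real.abs_sin_le_one _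
  rw [intervalIntegral_integral_swap hint]
  simp_rw [(hN _).cos_displacement a t]
  rw [integral_sub (integrable_const _), integral_const_mul]
  · simp
  · refine Integrable.const_mul ?_ _
    have := hint.integral_prod_right
    rcases le_total 0 t with h0 | h0
    · simpa only [intervalIntegral.integral_of_le h0, uIoc_of_le h0, Function.uncurry] using this
    · rw [uIoc_of_ge h0] at this
      simp only [intervalIntegral.integral_of_ge h0]
      exact this.neg

lemma integral_sign_mul_sin_displacement (h : IsPoissonProcess lam N P)
    (hN : ∀ ω, IsCountingPath fun t => N t ω) (a : ℝ) {T : ℝ} (hT : 0 ≤ T) :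
    ∫ ω, signPath (fun t => N t ω) T * Real.sin (a * displacement (fun t => N t ω) T) ∂P =
      a * ∫ s in (0 : ℝ)..T, Real.exp (-2 * lam * (T - s)) *
        ∫ ω, Real.cos (a * displacement (fun t => N t ω) s) ∂P := by
  have hT' : Measurable fun ω => signPath (fun t => N t ω) T :=
    (Measurable.of_discrete (f := fun k : ℕ => (-1 : ℝ) ^ k)).comp (h.measurable _)
  have hm : Measurable (fun p : ℝ × Ω => signPath (fun t => N t p.2) T *
      (signPath (fun t => N t p.2) p.1 * Real.cos (a * displacement (fun t => N t p.2) p.1))) :=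
    (hT'.comp measurable_snd).mul ((measurable_uncurry_signPath h.measurable hN).mul
      (Real.measurable_cos.comp ((measurable_uncurry_displacement h.measurable hN).const_mul a)))
  have : IsFiniteMeasure (volume.restrict (uIoc 0 T)) := by rw [uIoc]; infer_instance
  have hint : Integrable (Function.uncurry fun (s : ℝ) ω => signPath (fun t => N t ω) T *
      (signPath (fun t => N t ω) s * Real.cos (a * displacement (fun t => N t ω) s)))
      ((volume.restrict (uIoc 0 T)).prod P) := by
    refine (integrable_const (1 : ℝ)).mono' hm.aestronglyMeasurable (ae_of_all _ fun p => ?_)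
    simpa [Function.uncurry, abs_mul, abs_signPath] using Real.abs_cos_le_one _
  have h1 : ∀ ω, signPath (fun t => N t ω) T * Real.sin (a * displacement (fun t => N t ω) T)
      = a * ∫ s in (0 : ℝ)..T, signPath (fun t => N t ω) T * (signPath (fun t => N t ω) s *
        Real.cos (a * displacement (fun t => N t ω) s)) := by
    intro ω
    rw [(hN ω).sin_displacement a T, intervalIntegral.integral_const_mul]; ring
  simp_rw [h1]
  rw [integral_const_mul, ← intervalIntegral_integral_swap hint]
  congr 1
  refine intervalIntegral.integral_congr fun s hs => ?_
  rw [uIcc_of_le hT] at hs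
  exact h.integral_sign_mul_cos hN hs.1 hs.2 a

end IsPoissonProcess

end

/-! ### The entire functions cosh √y, sinh √y / √y and (cosh √y - 1) / y -/

/-- The entire function `∑ yⁿ / (2n + i)!`. For `i = 0` and `y = w ^ 2` it is `cosh w`. -/
noncomputable def hypSeries (i : ℕ) (y : ℝ) : ℝ := ∑' n : ℕ, y ^ n / (2 * n + i).factorial

lemma summable_hypSeries (i : ℕ) (y : ℝ) :
    Summable fun n : ℕ => y ^ n / (2 * n + i).factorial := by
  refine Summable.of_norm_bounded (Real.summable_pow_div_factorial |y|) fun n => ?_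
  rw [norm_div, norm_pow, Real.norm_eq_abs, RCLike.norm_natCast]
  gcongr
  omega

lemma hasSum_hypSeries (i : ℕ) (y : ℝ) :
    HasSum (fun n : ℕ => y ^ n / (2 * n + i).factorial) (hypSeries i y) :=
  (summable_hypSeries i y).hasSum

lemma hypSeries_zero_sq (w : ℝ) : hypSeries 0 (w ^ 2) = Real.cosh w := by
  refine (hasSum_hypSeries 0 _).unique ((Real.hasSum_cosh w).congr_fun fun n => ?_)
  rw [pow_mul, add_zero]

lemma hypSeries_zero_neg_sq (w : ℝ) : hypSeries 0 (-w ^ 2) = Real.cos w := by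
  refine (hasSum_hypSeries 0 _).unique ((Real.hasSum_cos w).congr_fun fun n => ?_)
  rw [pow_mul, add_zero, ← mul_pow]; ring

lemma mul_hypSeries_one_sq (w : ℝ) : w * hypSeries 1 (w ^ 2) = Real.sinh w := by
  refine ((hasSum_hypSeries 1 _).mul_left w).unique ((Real.hasSum_sinh w).congr_fun fun n => ?_)
  rw [pow_succ w (2 * n), pow_mul]; ring

lemma mul_hypSeries_one_neg_sq (w : ℝ) : w * hypSeries 1 (-w ^ 2) = Real.sin w := by
  refine ((hasSum_hypSeries 1 _).mul_left w).unique ((Real.hasSum_sin w).congr_fun fun n => ?_)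
  rw [pow_succ w (2 * n), pow_mul, neg_pow (w ^ 2)]; ring

lemma hypSeries_at_zero (i : ℕ) : hypSeries i 0 = 1 / i.factorial := by
  rw [hypSeries, tsum_eq_single 0 (fun n hn => by simp [hn])]; simp

lemma mul_hypSeries_two (y : ℝ) : y * hypSeries 2 y = hypSeries 0 y - 1 := by
  have h1 := (hasSum_nat_add_iff' 1).2 (hasSum_hypSeries 0 y)
  simp only [Finset.range_one, Finset.sum_singleton, pow_zero, mul_zero, add_zero,
    Nat.factorial_zero, Nat.cast_one, div_one] at h1
  refine ((hasSum_hypSeries 2 y).mul_left y).unique (h1.congr_fun fun n => ?_)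
  rw [pow_succ, show 2 * (n + 1) = 2 * n + 2 by ring]; ring

lemma eq_sq_or_eq_neg_sq (y : ℝ) : ∃ w : ℝ, y = w ^ 2 ∨ y = -w ^ 2 := by
  rcases le_total 0 y with h | h
  · exact ⟨√y, Or.inl (Real.sq_sqrt h).symm⟩
  · exact ⟨√(-y), Or.inr (by rw [Real.sq_sqrt (by linarith)]; ring)⟩

lemma hypSeries_sq_sub (y : ℝ) : hypSeries 0 y ^ 2 - y * hypSeries 1 y ^ 2 = 1 := by
  obtain ⟨w, rfl | rfl⟩ := eq_sq_or_eq_neg_sq y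
  · rw [← mul_pow, mul_hypSeries_one_sq, hypSeries_zero_sq, Real.cosh_sq]; ring
  · rw [neg_mul, ← mul_pow, mul_hypSeries_one_neg_sq, hypSeries_zero_neg_sq]
    linarith [Real.sin_sq_add_cos_sq w]

lemma hypSeries_zero_four_mul (y : ℝ) : hypSeries 0 (4 * y) = 2 * hypSeries 0 y ^ 2 - 1 := by
  obtain ⟨w, rfl | rfl⟩ := eq_sq_or_eq_neg_sq y
  · rw [show 4 * w ^ 2 = (2 * w) ^ 2 by ring, hypSeries_zero_sq, hypSeries_zero_sq,
      Real.cosh_two_mul, Real.sinh_sq]; ring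
  · rw [show 4 * -w ^ 2 = -(2 * w) ^ 2 by ring, hypSeries_zero_neg_sq, hypSeries_zero_neg_sq,
      Real.cos_two_mul]

lemma hypSeries_one_four_mul (y : ℝ) :
    hypSeries 1 (4 * y) = hypSeries 0 y * hypSeries 1 y := by
  obtain ⟨w, hw⟩ := eq_sq_or_eq_neg_sq y
  rcases eq_or_ne w 0 with rfl | h0
  · have : y = 0 := by simpa using hw
    simp [this, hypSeries_at_zero]
  have h2 : 2 * w ≠ 0 := by positivity
  apply mul_left_cancel₀ h2
  rcases hw with rfl | rfl
  · rw [show 4 * w ^ 2 = (2 * w) ^ 2 by ring, mul_hypSeries_one_sq, Real.sinh_two_mul,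
      ← mul_hypSeries_one_sq, hypSeries_zero_sq]; ring
  · rw [show 4 * -w ^ 2 = -(2 * w) ^ 2 by ring, mul_hypSeries_one_neg_sq, Real.sin_two_mul,
      ← mul_hypSeries_one_neg_sq, hypSeries_zero_neg_sq]; ring

lemma hypSeries_two_four_mul (y : ℝ) : hypSeries 2 (4 * y) = hypSeries 1 y ^ 2 / 2 := by
  rcases eq_or_ne y 0 with rfl | h0
  · simp [hypSeries_at_zero]
  have h2 : 4 * y ≠ 0 := by simpa using h0
  apply mul_left_cancel₀ h2
  rw [mul_hypSeries_two, hypSeries_zero_four_mul]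
  linarith [hypSeries_sq_sub y]

/-- Linearizes the square of the characteristic function, so that each summand can be inverted
separately. -/
lemma sq_hypSeries_add (L y : ℝ) : (hypSeries 0 y + L * hypSeries 1 y) ^ 2 =
    1 / 2 + hypSeries 0 (4 * y) / 2 + 2 * L * hypSeries 1 (4 * y)
      + 2 * L ^ 2 * hypSeries 2 (4 * y) := by
  rw [hypSeries_zero_four_mul, hypSeries_one_four_mul, hypSeries_two_four_mul]; ring

/-- `t ↦ cosh (√θ t)` and `t ↦ sinh (√θ t) / √θ` satisfy the expected differential equations. -/
lemma hasDerivAt_hypSeries (θ t : ℝ) :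
    HasDerivAt (fun t => hypSeries 0 (θ * t ^ 2)) (θ * (t * hypSeries 1 (θ * t ^ 2))) t ∧
    HasDerivAt (fun t => t * hypSeries 1 (θ * t ^ 2)) (hypSeries 0 (θ * t ^ 2)) t := by
  obtain ⟨w, hw⟩ := eq_sq_or_eq_neg_sq θ
  rcases eq_or_ne w 0 with rfl | h0
  · have : θ = 0 := by simpa using hw
    subst this
    simp [hypSeries_at_zero, hasDerivAt_const, hasDerivAt_id']
  rcases hw with rfl | rfl
  · have e1 : ∀ t : ℝ, hypSeries 0 (w ^ 2 * t ^ 2) = Real.cosh (w * t) := fun t => by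
      rw [← mul_pow, hypSeries_zero_sq]
    have e2 : ∀ t : ℝ, t * hypSeries 1 (w ^ 2 * t ^ 2) = w⁻¹ * Real.sinh (w * t) := fun t => by
      rw [← mul_pow, ← mul_hypSeries_one_sq]; field_simp
    simp_rw [e1, e2]
    have h := (hasDerivAt_id' t).const_mul w
    constructor
    · convert! h.cosh using 1; field_simp
    · convert! h.sinh.const_mul w⁻¹ using 1; field_simp
  · have e1 : ∀ t : ℝ, hypSeries 0 (-w ^ 2 * t ^ 2) = Real.cos (w * t) := fun t => by
      rw [neg_mul, ← mul_pow, hypSeries_zero_neg_sq]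
    have e2 : ∀ t : ℝ, t * hypSeries 1 (-w ^ 2 * t ^ 2) = w⁻¹ * Real.sin (w * t) := fun t => by
      rw [neg_mul, ← mul_pow, ← mul_hypSeries_one_neg_sq]; field_simp
    simp_rw [e1, e2]
    have h := (hasDerivAt_id' t).const_mul w
    constructor
    · convert! h.cos using 1; field_simp
    · convert! h.sin.const_mul w⁻¹ using 1; field_simp

/-! ### The telegraph system and the characteristic function of one process -/

/-- The explicit pair (U, V) solves the same linear system with the same initial values, and a
decreasing energy forces uniqueness. -/
lemma eq_of_telegraph_integral_equations {lam a : ℝ} (hlam : 0 ≤ lam) {f g : ℝ → ℝ}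
    (hf : Continuous f) (h1 : ∀ t, 0 ≤ t → f t = 1 - a * ∫ s in (0 : ℝ)..t, g s)
    (h2 : ∀ t, 0 ≤ t → g t = a * ∫ s in (0 : ℝ)..t, Real.exp (-2 * lam * (t - s)) * f s)
    {t : ℝ} (ht : 0 ≤ t) :
    f t = Real.exp (-lam * t) * (hypSeries 0 ((lam ^ 2 - a ^ 2) * t ^ 2)
      + lam * (t * hypSeries 1 ((lam ^ 2 - a ^ 2) * t ^ 2))) := by
  set θ := lam ^ 2 - a ^ 2 with hθ
  -- The equations are known only for t ≥ 0; `G` and `F` agree with `g` and `f` there and are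
  -- differentiable on the whole line.
  let G : ℝ → ℝ := fun t => a * (Real.exp (-2 * lam * t) *
    ∫ s in (0 : ℝ)..t, Real.exp (2 * lam * s) * f s)
  have hcf : Continuous fun s => Real.exp (2 * lam * s) * f s := by fun_prop
  have hG : ∀ t, HasDerivAt G (a * f t - 2 * lam * G t) t := by
    intro t
    have e1 := (((hasDerivAt_id' t).const_mul (-2 * lam)).exp.mul
      (hcf.integral_hasStrictDerivAt 0 t).hasDerivAt).const_mul a
    convert! e1 using 1
    have : Real.exp (-2 * lam * t) * Real.exp (2 * lam * t) = 1 := by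
      rw [← Real.exp_add]; simp
    simp only [G]
    linear_combination (- a * f t) * this
  have hgG : ∀ t, 0 ≤ t → g t = G t := by
    intro t ht
    rw [h2 t ht]
    simp only [G]
    rw [← intervalIntegral.integral_const_mul (Real.exp (-2 * lam * t))]
    congr 2
    funext s
    rw [← mul_assoc, ← Real.exp_add]
    ring_nf
  have hGc : Continuous G := continuous_iff_continuousAt.2 fun t => (hG t).continuousAt
  let F : ℝ → ℝ := fun t => 1 - a * ∫ s in (0 : ℝ)..t, G s
  have hF : ∀ t, HasDerivAt F (-a * G t) t := by
    intro t
    convert! ((hGc.integral_hasStrictDerivAt 0 t).hasDerivAt.const_mul a).const_sub 1 using 1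
    ring
  have hfF : ∀ t, 0 ≤ t → f t = F t := by
    intro t ht
    rw [h1 t ht]
    simp only [F]
    congr 2
    refine intervalIntegral.integral_congr fun s hs => ?_
    rw [uIcc_of_le ht] at hs
    exact hgG s hs.1
  let U : ℝ → ℝ := fun t => Real.exp (-lam * t) * (hypSeries 0 (θ * t ^ 2)
      + lam * (t * hypSeries 1 (θ * t ^ 2)))
  let V : ℝ → ℝ := fun t => a * (Real.exp (-lam * t) * (t * hypSeries 1 (θ * t ^ 2)))
  have hU : ∀ t, HasDerivAt U (-a * V t) t := by
    intro t
    convert! (((hasDerivAt_id' t).const_mul (-lam)).exp.mul ((hasDerivAt_hypSeries θ t).1.add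
      ((hasDerivAt_hypSeries θ t).2.const_mul lam))) using 1
    simp only [V, hθ]
    simp only [Pi.add_apply]
    ring
  have hV : ∀ t, HasDerivAt V (a * U t - 2 * lam * V t) t := by
    intro t
    convert! (((hasDerivAt_id' t).const_mul (-lam)).exp.mul
      (hasDerivAt_hypSeries θ t).2).const_mul a using 1
    simp only [U, V]
    ring
  -- For t > 0, where f = F, the cross terms cancel and the derivative is -4λ(G - V)² ≤ 0.
  have hE : ∀ t, HasDerivAt (fun t => (F t - U t) ^ 2 + (G t - V t) ^ 2)
      (2 * (F t - U t) * (-a * (G t - V t)) +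
        2 * (G t - V t) * (a * (f t - U t) - 2 * lam * (G t - V t))) t := by
    intro t
    convert! (((hF t).sub (hU t)).pow 2).add (((hG t).sub (hV t)).pow 2) using 1
    simp only [Pi.sub_apply]
    ring
  have hanti : AntitoneOn (fun t => (F t - U t) ^ 2 + (G t - V t) ^ 2) (Ici 0) := by
    refine antitoneOn_of_deriv_nonpos (convex_Ici 0)
      (fun t _ => (hE t).continuousAt.continuousWithinAt)
      (fun t _ => (hE t).differentiableAt.differentiableWithinAt) fun t ht => ?_
    rw [interior_Ici] at ht
    rw [(hE t).deriv, hfF t (le_of_lt ht)]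
    nlinarith [mul_nonneg hlam (sq_nonneg (G t - V t))]
  have h0 : (F 0 - U 0) ^ 2 + (G 0 - V 0) ^ 2 = 0 := by
    simp [F, U, G, V, hypSeries_at_zero]
  have h3 := hanti (mem_Ici.2 le_rfl) (mem_Ici.2 ht) ht
  simp only [h0] at h3
  have h4 : (F t - U t) ^ 2 = 0 := by nlinarith [sq_nonneg (F t - U t), sq_nonneg (G t - V t)]
  rw [hfF t ht]
  exact sub_eq_zero.1 (pow_eq_zero_iff two_ne_zero |>.1 h4)

section

variable {Ω : Type*} [MeasurableSpace Ω]

lemma IsPoissonProcess.integral_cos_displacement_eq {P : Measure Ω} [IsProbabilityMeasure P]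
    {lam : ℝ≥0} {N : ℝ≥0 → Ω → ℕ} (h : IsPoissonProcess lam N P)
    (hN : ∀ ω, IsCountingPath fun t => N t ω) (a : ℝ) {t : ℝ} (ht : 0 ≤ t) :
    ∫ ω, Real.cos (a * displacement (fun t => N t ω) t) ∂P =
      Real.exp (-lam * t) * (hypSeries 0 ((lam ^ 2 - a ^ 2) * t ^ 2)
      + lam * (t * hypSeries 1 ((lam ^ 2 - a ^ 2) * t ^ 2))) := by
  refine eq_of_telegraph_integral_equations
    (f := fun t => ∫ ω, Real.cos (a * displacement (fun t => N t ω) t) ∂P)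
    (g := fun t => ∫ ω, signPath (fun t => N t ω) t *
      Real.sin (a * displacement (fun t => N t ω) t) ∂P) lam.2 ?_
    (fun t _ => h.integral_cos_displacement hN a t)
    (fun t ht => h.integral_sign_mul_sin_displacement hN a ht) ht
  refine continuous_of_dominated (bound := fun _ => 1) (fun t => ?_)
    (fun t => ae_of_all _ fun ω => by simpa using Real.abs_cos_le_one _) (integrable_const _)
    (ae_of_all _ fun ω => ?_)
  · exact (Real.measurable_cos.comp
      ((measurable_displacement h.measurable hN t).const_mul a)).aestronglyMeasurable
  · have := (hN ω).continuous_displacement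
    fun_prop

lemma IsTelegraphProcess.aemeasurable_and_charFun {P : Measure Ω} [IsProbabilityMeasure P]
    {c : ℝ} {lam : ℝ≥0} {X : ℝ≥0 → Ω → ℝ} (hX : IsTelegraphProcess c lam X P) (t : ℝ≥0) :
    AEMeasurable (X t) P ∧ ∀ α : ℝ, charFun (P.map (X t)) α =
      ((Real.exp (-lam * t) * (hypSeries 0 ((lam ^ 2 - (α * c) ^ 2) * t ^ 2)
      + lam * (t * hypSeries 1 ((lam ^ 2 - (α * c) ^ 2) * t ^ 2))) : ℝ) : ℂ) := by
  obtain ⟨D, N₀, hD, hD1, hD2, hP₀, hind₀, hX⟩ := hX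
  obtain ⟨N, hP, hN, hNN⟩ := hP₀.exists_countingPath_version
  have hind : IndepFun D (fun ω t => N t ω) P := by
    refine hind₀.congr .rfl ?_
    filter_upwards [hNN] with ω hω
    funext t; exact (hω t).symm
  have hXt : X t =ᵐ[P] fun ω => D ω * c * displacement (fun s => N s ω) t := by
    filter_upwards [hNN, hX] with ω h1 h2
    rw [h2, telegraphPosition_eq]
    simp only [h1]
  have hmY : Measurable fun ω => displacement (fun s => N s ω) t :=
    measurable_displacement hP.measurable hN t
  refine ⟨((hD.mul_const c).mul hmY).aemeasurable.congr hXt.symm, fun α => ?_⟩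
  have hindY : IndepFun D (fun ω => displacement (fun s => N s ω) t) P := by
    -- Measurability of the displacement is applied on Ω with the σ-algebra generated by `N`, which
    -- makes it a function of `N` as far as independence is concerned.
    have hle : MeasurableSpace.comap (fun ω => displacement (fun s => N s ω) t) inferInstance ≤
        MeasurableSpace.comap (fun ω t => N t ω) MeasurableSpace.pi := by
      rw [← measurable_iff_comap_le]
      refine @measurable_displacement Ω
        (MeasurableSpace.comap (fun ω t => N t ω) MeasurableSpace.pi) N (fun s => ?_) hN t
      exact (measurable_pi_apply s).comp (comap_measurable (fun ω t => N t ω))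
    exact indep_of_indep_of_le_right hind hle
  have hm1 : MeasurableSet {ω | D ω = 1} := hD (measurableSet_singleton 1)
  have hm2 : MeasurableSet {ω | D ω = -1} := hD (measurableSet_singleton (-1))
  have hDae : ∀ᵐ ω ∂P, D ω = 1 ∨ D ω = -1 := by
    have hdisj : Disjoint {ω | D ω = 1} {ω | D ω = -1} := by
      rw [Set.disjoint_left]; intro ω h1 h2
      simp only [mem_ofPred_eq] at h1 h2
      linarith
    have h3 : P ({ω | D ω = 1} ∪ {ω | D ω = -1}) = 1 := by
      rw [measure_union hdisj hm2, hD1, hD2, ENNReal.add_halves]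
    exact (prob_compl_eq_zero_iff (hm1.union hm2)).2 h3
  have hED : ∫ ω, D ω ∂P = 0 := by
    have h4 : D =ᵐ[P] fun ω => {ω | D ω = 1}.indicator (fun _ => (1 : ℝ)) ω
        - {ω | D ω = -1}.indicator (fun _ => (1 : ℝ)) ω := by
      filter_upwards [hDae] with ω hω
      rcases hω with h | h <;> simp [indicator, h] <;> norm_num
    rw [integral_congr_ae h4, integral_sub ((integrable_const _).indicator hm1)
      ((integrable_const _).indicator hm2), integral_indicator_const _ hm1,
      integral_indicator_const _ hm2]
    simp [measureReal_def, hD1, hD2]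
  rw [← hP.integral_cos_displacement_eq hN (α * c) (NNReal.coe_nonneg t), charFun_apply_real,
    integral_map (((hD.mul_const c).mul hmY).aemeasurable.congr hXt.symm)
      (by fun_prop : Continuous fun x : ℝ => Complex.exp (α * x * Complex.I)).aestronglyMeasurable]
  set Y : Ω → ℝ := fun ω => displacement (fun s => N s ω) t with hY
  -- As D = ±1, it drops out of the cosine and factors out of the sine; the sine part then has mean
  -- zero because E D = 0.
  have h5 : ∀ᵐ ω ∂P, Complex.exp (α * X t ω * Complex.I) =
      ((Real.cos (α * c * Y ω) : ℝ) : ℂ) + ((D ω * Real.sin (α * c * Y ω) : ℝ) : ℂ) * Complex.I := by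
    filter_upwards [hXt, hDae] with ω h1 h2
    rw [h1]
    rcases h2 with h | h
    · rw [h, show ((α : ℂ) * ((1 * c * Y ω : ℝ) : ℂ)) = ((α * c * Y ω : ℝ) : ℂ) by push_cast; ring,
        Complex.exp_mul_I]
      push_cast; ring
    · rw [h, show ((α : ℂ) * ((-1 * c * Y ω : ℝ) : ℂ)) = -((α * c * Y ω : ℝ) : ℂ) by
        push_cast; ring, Complex.exp_mul_I, Complex.cos_neg, Complex.sin_neg]
      push_cast; ring
  have hmsin : Measurable fun ω => Real.sin (α * c * Y ω) :=
    Real.measurable_sin.comp (hmY.const_mul _)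
  have hmcos : Measurable fun ω => Real.cos (α * c * Y ω) :=
    Real.measurable_cos.comp (hmY.const_mul _)
  have i1 : Integrable (fun ω => Real.cos (α * c * Y ω)) P :=
    (integrable_const (1 : ℝ)).mono' hmcos.aestronglyMeasurable
      (ae_of_all _ fun ω => by simpa using Real.abs_cos_le_one _)
  have i2 : Integrable (fun ω => D ω * Real.sin (α * c * Y ω)) P := by
    refine (integrable_const (1 : ℝ)).mono' (hD.mul hmsin).aestronglyMeasurable ?_
    filter_upwards [hDae] with ω h
    rcases h with h | h <;> simpa [h] using Real.abs_sin_le_one _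
  rw [integral_congr_ae h5, integral_add i1.ofReal (i2.ofReal.mul_const _),
    integral_mul_const, integral_complex_ofReal, integral_complex_ofReal]
  have h6 : ∫ ω, D ω * Real.sin (α * c * Y ω) ∂P = 0 := by
    have h7 := (hindY.comp (φ := id) (ψ := fun y => Real.sin (α * c * y)) measurable_id
      (by fun_prop)).integral_fun_mul_eq_mul_integral hD.aestronglyMeasurable
      hmsin.aestronglyMeasurable
    simp only [Function.comp_def, id] at h7
    rw [h7, hED, zero_mul]
  rw [h6]
  simp [hY]

end

/-! ### Cosine transforms of moment families -/

/-- Summation of a double binomial series along its antidiagonals. -/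
lemma hasSum_binomial_double {c : ℕ → ℝ} {a b : ℝ}
    (hc : Summable fun n => |c n| * (|a| + |b|) ^ n) {g : ℕ → ℝ}
    (hg : ∀ k, HasSum (fun j => c (k + j) * (k + j).choose k * a ^ k * b ^ j) (g k)) :
    HasSum g (∑' n, c n * (a + b) ^ n) := by
  let u : ℕ × ℕ → ℝ := fun p => c (p.1 + p.2) * (p.1 + p.2).choose p.1 * a ^ p.1 * b ^ p.2
  have hsum : ∀ (d : ℕ → ℝ) (x y : ℝ) (n : ℕ), ∑ p ∈ Finset.HasAntidiagonal.antidiagonal n,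
      d (p.1 + p.2) * (p.1 + p.2).choose p.1 * x ^ p.1 * y ^ p.2 = d n * (x + y) ^ n := by
    intro d x y n
    rw [(Commute.all x y).add_pow', Finset.mul_sum]
    refine Finset.sum_congr rfl fun p hp => ?_
    rw [Finset.HasAntidiagonal.mem_antidiagonal.1 hp, nsmul_eq_mul]; ring
  -- By the binomial theorem the absolute values on the n-th antidiagonal sum to |c n| (|a| +
  -- |b|)^n.
  have hu : Summable u := by
    rw [← Finset.HasAntidiagonal.sigmaAntidiagonalEquivProd.summable_iff]
    refine Summable.of_norm ?_
    rw [summable_sigma_of_nonneg (fun _ => norm_nonneg _)]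
    refine ⟨fun n => (hasSum_fintype _).summable, hc.congr fun n => ?_⟩
    rw [tsum_fintype, ← hsum (fun n => |c n|) |a| |b| n, Finset.univ_eq_attach,
      ← Finset.sum_attach]
    refine Finset.sum_congr rfl fun p _ => ?_
    simp [u, Finset.HasAntidiagonal.sigmaAntidiagonalEquivProd]
  have h1 : HasSum g (∑' p, u p) := hu.hasSum.prod_fiberwise hg
  have h2 : HasSum (fun n => c n * (a + b) ^ n) (∑' p, u p) := by
    have := (Finset.HasAntidiagonal.sigmaAntidiagonalEquivProd.hasSum_iff.2 hu.hasSum).sigma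
      (fun n => hasSum_fintype _)
    refine this.congr_fun fun n => ?_
    rw [← hsum c a b n, Finset.univ_eq_attach, ← Finset.sum_attach]
    refine Finset.sum_congr rfl fun p _ => ?_
    simp [u, Finset.HasAntidiagonal.sigmaAntidiagonalEquivProd]
  rwa [h2.tsum_eq]

/-- A sequence of functions on `[0, 1]` vanishing at `1`, each being an antiderivative of a
multiple of `z` times the preceding one, with the even moments of the first one prescribed. -/
structure IsMomentFamily (i : ℕ) (Φ : ℕ → ℝ → ℝ) : Prop where
  continuous_zero : Continuous (Φ 0)
  hasDerivAt_succ : ∀ k z, HasDerivAt (Φ (k + 1)) (-2 * (k + 1) * z * Φ k z) z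
  -- Index 0 is excluded because (1 - z²)^0 does not vanish at 1.
  one : ∀ k, Φ (k + 1) 1 = 0
  nonneg_zero : ∀ z ∈ Icc (0 : ℝ) 1, 0 ≤ Φ 0 z
  le_one : ∀ k, Φ k 0 ≤ 1
  le_one_zero : ∀ z ∈ Icc (0 : ℝ) 1, Φ 0 z ≤ 1
  moment_zero : ∀ j, ∫ z in (0 : ℝ)..1, z ^ (2 * j) * Φ 0 z =
    (2 * j).factorial / (2 * j + i).factorial

namespace IsMomentFamily

variable {i : ℕ} {Φ : ℕ → ℝ → ℝ}

lemma continuous (h : IsMomentFamily i Φ) : ∀ k, Continuous (Φ k)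
  | 0 => h.continuous_zero
  | k + 1 => continuous_iff_continuousAt.2 fun z => (h.hasDerivAt_succ k z).continuousAt

lemma antitoneOn (h : IsMomentFamily i Φ) {k : ℕ} (hk : ∀ z ∈ Icc (0 : ℝ) 1, 0 ≤ Φ k z) :
    AntitoneOn (Φ (k + 1)) (Icc 0 1) := by
  refine antitoneOn_of_deriv_nonpos (convex_Icc 0 1) (h.continuous _).continuousOn
    (fun z _ => (h.hasDerivAt_succ k z).differentiableAt.differentiableWithinAt) fun z hz => ?_
  rw [interior_Icc] at hz
  rw [(h.hasDerivAt_succ k z).deriv]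
  have := mul_nonneg (mul_nonneg (by positivity : (0 : ℝ) ≤ 2 * (k + 1)) hz.1.le)
    (hk z ⟨hz.1.le, hz.2.le⟩)
  linarith

lemma nonneg (h : IsMomentFamily i Φ) (k : ℕ) : ∀ z ∈ Icc (0 : ℝ) 1, 0 ≤ Φ k z := by
  induction k with
  | zero => exact h.nonneg_zero
  | succ k ih =>
    intro z hz
    have := h.antitoneOn ih hz (right_mem_Icc.2 zero_le_one) hz.2
    rwa [h.one k] at this

lemma le_one' (h : IsMomentFamily i Φ) (k : ℕ) : ∀ z ∈ Icc (0 : ℝ) 1, Φ k z ≤ 1 := by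
  cases k with
  | zero => exact h.le_one_zero
  | succ k =>
    intro z hz
    exact (h.antitoneOn (h.nonneg k) (left_mem_Icc.2 zero_le_one) hz hz.1).trans (h.le_one _)

/-- Integration by parts: z^(2j+1) Φ_(k+1) vanishes at both endpoints. -/
lemma moment_succ (h : IsMomentFamily i Φ) (k j : ℕ) :
    (2 * j + 1) * ∫ z in (0 : ℝ)..1, z ^ (2 * j) * Φ (k + 1) z =
      2 * (k + 1) * ∫ z in (0 : ℝ)..1, z ^ (2 * (j + 1)) * Φ k z := by
  have hc := h.continuous
  have hc1 := hc k
  have hc2 := hc (k + 1)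
  have e := intervalIntegral.integral_eq_sub_of_hasDerivAt (a := 0) (b := 1)
    (f := fun z => z ^ (2 * j + 1) * Φ (k + 1) z)
    (f' := fun z => (2 * j + 1) * (z ^ (2 * j) * Φ (k + 1) z) -
      2 * (k + 1) * (z ^ (2 * (j + 1)) * Φ k z))
    (fun z _ => by
      convert! (hasDerivAt_pow (2 * j + 1) z).mul (h.hasDerivAt_succ k z) using 1
      push_cast
      ring)
    ((by fun_prop : Continuous fun z => (2 * j + 1) * (z ^ (2 * j) * Φ (k + 1) z) -
      2 * (k + 1) * (z ^ (2 * (j + 1)) * Φ k z)).intervalIntegrable _ _)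
  rw [intervalIntegral.integral_sub (Continuous.intervalIntegrable (by fun_prop) _ _)
    (Continuous.intervalIntegrable (by fun_prop) _ _), intervalIntegral.integral_const_mul,
    intervalIntegral.integral_const_mul, h.one k] at e
  simp at e
  linarith

lemma moment (h : IsMomentFamily i Φ) (k j : ℕ) :
    ∫ z in (0 : ℝ)..1, z ^ (2 * j) * Φ k z =
      4 ^ k * k.factorial * (2 * j).factorial * (k + j).factorial /
        (j.factorial * (2 * (k + j) + i).factorial) := by
  induction k generalizing j with
  | zero =>
    rw [h.moment_zero]
    have := j.factorial_ne_zero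
    simp only [pow_zero, Nat.factorial_zero, zero_add]
    field_simp
    simp
  | succ k ih =>
    have e := h.moment_succ k j
    rw [ih (j + 1)] at e
    have h0 : (2 * (j : ℝ) + 1) ≠ 0 := by positivity
    apply mul_left_cancel₀ h0
    rw [e, show k + (j + 1) = k + 1 + j by ring, show 2 * (j + 1) = 2 * j + 1 + 1 by ring]
    simp only [Nat.factorial_succ (2 * j + 1), Nat.factorial_succ (2 * j), Nat.factorial_succ k,
      Nat.factorial_succ j]
    push_cast
    field_simp
    ring

/-- The cosine series is integrated term by term; 0 ≤ Φ_k ≤ 1 lets the series of cosh β dominate.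
The moments are exactly what produces a row of the double binomial expansion in 4L² and -β². -/
lemma hasSum_integral_cos (h : IsMomentFamily i Φ) (k : ℕ) (β : ℝ) :
    HasSum (fun j : ℕ => (k.factorial : ℝ) ^ 2 * (1 / (2 * (k + j) + i).factorial
      * (k + j).choose k * 4 ^ k * (-β ^ 2) ^ j))
      (∫ z in (0 : ℝ)..1, Real.cos (β * z) * Φ k z) := by
  have hc := h.continuous k
  have key := intervalIntegral.hasSum_integral_of_dominated_convergence (a := 0) (b := 1)
    (μ := volume) (F := fun (j : ℕ) z => (-1) ^ j * (β * z) ^ (2 * j) / (2 * j).factorial * Φ k z)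
    (f := fun z => Real.cos (β * z) * Φ k z)
    (fun (j : ℕ) _ => β ^ (2 * j) / (2 * j).factorial)
    (fun j => (Continuous.aestronglyMeasurable (by fun_prop)))
    (fun j => ae_of_all _ fun z hz => ?_) (ae_of_all _ fun z _ => (Real.hasSum_cosh β).summable)
    intervalIntegrable_const (ae_of_all _ fun z _ => (Real.hasSum_cos (β * z)).mul_right _)
  · refine key.congr_fun fun j => ?_
    have e : (fun z => (-1) ^ j * (β * z) ^ (2 * j) / (2 * j).factorial * Φ k z) =
        fun z => ((-1) ^ j * β ^ (2 * j) / (2 * j).factorial) * (z ^ (2 * j) * Φ k z) := by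
      funext z; rw [mul_pow]; ring
    rw [e, intervalIntegral.integral_const_mul, h.moment, neg_pow (β ^ 2), ← pow_mul,
      Nat.cast_add_choose]
    have := (2 * j).factorial_ne_zero
    field_simp
  · rw [uIoc_of_le zero_le_one] at hz
    have hz' : z ∈ Icc (0 : ℝ) 1 := ⟨hz.1.le, hz.2⟩
    rw [Real.norm_eq_abs, abs_mul, abs_of_nonneg (h.nonneg k z hz'), abs_div, abs_mul, abs_pow]
    simp only [abs_neg, abs_one, one_pow, one_mul, Nat.abs_cast]
    rw [pow_mul, abs_of_nonneg (by positivity), mul_pow, pow_mul β, mul_pow]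
    have h1 : (z ^ 2) ^ j ≤ 1 := pow_le_one₀ (sq_nonneg z) (pow_le_one₀ hz'.1 hz'.2)
    have h2 := h.le_one' k z hz'
    have h3 := h.nonneg k z hz'
    have h4 : (0 : ℝ) ≤ (β ^ 2) ^ j / (2 * j).factorial := by positivity
    calc (β ^ 2) ^ j * (z ^ 2) ^ j / (2 * j).factorial * Φ k z
        = (β ^ 2) ^ j / (2 * j).factorial * ((z ^ 2) ^ j * Φ k z) := by ring
      _ ≤ (β ^ 2) ^ j / (2 * j).factorial * 1 :=
        mul_le_mul_of_nonneg_left (mul_le_one₀ h1 h3 h2) h4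
      _ = _ := mul_one _

end IsMomentFamily

lemma summable_abs_hypSeries (i : ℕ) (x : ℝ) :
    Summable fun n : ℕ => |1 / ((2 * n + i).factorial : ℝ)| * x ^ n :=
  (summable_hypSeries i x).congr fun n => by
    rw [abs_of_nonneg (by positivity)]; ring

lemma hypSeries_eq_tsum (i : ℕ) (x : ℝ) :
    ∑' n : ℕ, 1 / ((2 * n + i).factorial : ℝ) * x ^ n = hypSeries i x :=
  tsum_congr fun n => by ring

namespace IsMomentFamily

variable {i : ℕ} {Φ : ℕ → ℝ → ℝ}

lemma hasSum_bessel_cos (h : IsMomentFamily i Φ) (L β : ℝ) :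
    HasSum (fun k : ℕ => L ^ (2 * k) / (k.factorial : ℝ) ^ 2 *
      ∫ z in (0 : ℝ)..1, Real.cos (β * z) * Φ k z) (hypSeries i (4 * L ^ 2 - β ^ 2)) := by
  rw [sub_eq_add_neg, ← hypSeries_eq_tsum]
  refine hasSum_binomial_double (c := fun n => 1 / ((2 * n + i).factorial : ℝ))
    (summable_abs_hypSeries i _) fun k => ?_
  refine ((h.hasSum_integral_cos k β).mul_left (L ^ (2 * k) / (k.factorial : ℝ) ^ 2)).congr_fun
    fun j => ?_
  rw [mul_pow 4, pow_mul]
  field_simp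

/-- In the double series for `hypSeries 0`, row 0 is cos β. With n = k + j, row k+1 reduces to row k
of the family with i = 1, because (2n+2)! = 2(n+1)(2n+1)! and (k+1) C(n+1, k+1) = (n+1) C(n, k). -/
lemma hasSum_bessel_succ_cos (h : IsMomentFamily 1 Φ) (L β : ℝ) :
    HasSum (fun k : ℕ => L ^ (2 * k + 2) / ((k + 1) * (k.factorial : ℝ) ^ 2) *
      ∫ z in (0 : ℝ)..1, Real.cos (β * z) * Φ k z)
      ((hypSeries 0 (4 * L ^ 2 - β ^ 2) - Real.cos β) / 2) := by
  let W : ℕ → ℝ := fun k => Nat.casesOn k (Real.cos β) fun k =>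
    2 * (L ^ (2 * k + 2) / ((k + 1) * (k.factorial : ℝ) ^ 2) *
      ∫ z in (0 : ℝ)..1, Real.cos (β * z) * Φ k z)
  have hW : HasSum W (hypSeries 0 (4 * L ^ 2 - β ^ 2)) := by
    rw [sub_eq_add_neg, ← hypSeries_eq_tsum]
    refine hasSum_binomial_double (c := fun n => 1 / ((2 * n + 0).factorial : ℝ))
      (summable_abs_hypSeries 0 _) fun k => ?_
    cases k with
    | zero =>
      refine (Real.hasSum_cos β).congr_fun fun j => ?_
      simp only [zero_add, add_zero, Nat.choose_zero_right, neg_pow (β ^ 2), pow_mul]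
      simp
      ring
    | succ k =>
      have h1 := (h.hasSum_integral_cos k β).mul_left
        (2 * (L ^ (2 * k + 2) / ((k + 1) * (k.factorial : ℝ) ^ 2)))
      rw [mul_assoc 2] at h1
      refine h1.congr_fun fun j => ?_
      rw [show 2 * (k + 1 + j) + 0 = 2 * (k + j) + 1 + 1 by ring,
        show k + 1 + j = k + j + 1 by ring, Nat.factorial_succ (2 * (k + j) + 1),
        show L ^ (2 * k + 2) = (L ^ 2) ^ (k + 1) by rw [← pow_mul]; ring_nf, mul_pow 4]
      have h2 : ((k + j + 1).choose (k + 1) : ℝ) * (k + 1) = (k + j + 1) * (k + j).choose k := by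
        exact_mod_cast (Nat.add_one_mul_choose_eq (k + j) k).symm
      have h3 : ((k + j + 1).choose (k + 1) : ℝ) = (k + j + 1) * (k + j).choose k / (k + 1) := by
        rw [eq_div_iff (by positivity), h2]
      rw [h3]
      push_cast
      field_simp
      ring
  have := (hasSum_nat_add_iff' 1).2 hW
  simp only [Finset.range_one, Finset.sum_singleton, W] at this
  exact (this.div_const 2).congr_fun fun k => by ring

end IsMomentFamily

/-! ### The two polynomial families -/

lemma isMomentFamily_one_sub_sq : IsMomentFamily 1 fun k z => (1 - z ^ 2) ^ k where
  continuous_zero := by fun_prop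
  hasDerivAt_succ k z := by
    convert! ((hasDerivAt_pow 2 z).const_sub 1).pow (k + 1) using 1
    simp; ring
  one k := by simp
  nonneg_zero z _ := by simp
  le_one k := by simp
  le_one_zero z _ := by simp
  moment_zero j := by
    simp only [pow_zero, mul_one]
    rw [integral_pow, Nat.factorial_succ]
    have := (2 * j).factorial_ne_zero
    push_cast
    field_simp
    simp

lemma integral_one_sub_sq_pow (k : ℕ) (z : ℝ) :
    ∫ u in (0 : ℝ)..z, (1 - u ^ 2) ^ k =
      z * ∑ n ∈ Finset.range (k + 1), k.choose n * (-1) ^ n * (z ^ 2) ^ n / (2 * n + 1) := by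
  have e : ∀ u : ℝ, (1 - u ^ 2) ^ k =
      ∑ n ∈ Finset.range (k + 1), k.choose n * (-1) ^ n * u ^ (2 * n) := by
    intro u
    rw [sub_eq_neg_add, add_pow]
    refine Finset.sum_congr rfl fun n _ => ?_
    rw [neg_pow, ← pow_mul]; ring
  simp_rw [e]
  rw [intervalIntegral.integral_finsetSum
    (fun n _ => Continuous.intervalIntegrable (by fun_prop) _ _), Finset.mul_sum]
  refine Finset.sum_congr rfl fun n _ => ?_
  rw [intervalIntegral.integral_const_mul, integral_pow, ← pow_mul]
  push_cast
  simp
  ring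

/-- The polynomial in `|z|` equal to `∫ s in |z|..1, (s ^ 2 - z ^ 2) ^ k` on `[-1, 1]`. -/
noncomputable def coneIntegral (k : ℕ) (z : ℝ) : ℝ :=
  ∑ n ∈ Finset.range (k + 1), k.choose n * (-1) ^ n * z ^ (2 * n) / (2 * (k - n : ℕ) + 1)
    - (-4) ^ k * k.factorial ^ 2 / (2 * k + 1).factorial * z ^ (2 * k + 1)

/-- Reversing the sum gives (-1)^k ∫ (1-u²)^k over [0, 1], which the zeroth moment of the first
family evaluates as the coefficient of the odd power. -/
lemma coneIntegral_one (k : ℕ) : coneIntegral k 1 = 0 := by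
  have h := isMomentFamily_one_sub_sq.moment k 0
  have h2 := integral_one_sub_sq_pow k 1
  simp only [mul_zero, pow_zero, one_mul, Nat.factorial_zero, Nat.cast_one, mul_one, add_zero]
    at h
  rw [h] at h2
  simp only [one_mul, one_pow, mul_one] at h2
  rw [coneIntegral, ← Finset.sum_range_reflect]
  have e : ∀ n ∈ Finset.range (k + 1), (k.choose (k + 1 - 1 - n) : ℝ) * (-1) ^ (k + 1 - 1 - n) *
      1 ^ (2 * (k + 1 - 1 - n)) / (2 * (k - (k + 1 - 1 - n) : ℕ) + 1) =
      (-1) ^ k * (k.choose n * (-1) ^ n / (2 * n + 1)) := by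
    intro n hn
    have hn' : n ≤ k := Nat.lt_succ_iff.1 (Finset.mem_range.1 hn)
    rw [Nat.add_sub_cancel, Nat.sub_sub_self hn', Nat.choose_symm hn', one_pow]
    have : (-1 : ℝ) ^ (k - n) = (-1) ^ k * (-1) ^ n := by
      obtain ⟨d, rfl⟩ := Nat.exists_eq_add_of_le hn'
      rw [Nat.add_sub_cancel_left, pow_add, mul_right_comm, ← pow_add, ← two_mul, pow_mul]; simp
    rw [this]; ring
  rw [Finset.sum_congr rfl e, ← Finset.mul_sum, ← h2, neg_pow (4 : ℝ)]
  ring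

lemma hasDerivAt_coneIntegral_succ (k : ℕ) (z : ℝ) :
    HasDerivAt (coneIntegral (k + 1)) (-2 * (k + 1) * z * coneIntegral k z) z := by
  have h1 : HasDerivAt (fun z : ℝ => ∑ n ∈ Finset.range (k + 1 + 1),
      ((k + 1).choose n : ℝ) * (-1) ^ n * z ^ (2 * n) / (2 * (k + 1 - n : ℕ) + 1))
      (∑ n ∈ Finset.range (k + 1 + 1),
      ((k + 1).choose n : ℝ) * (-1) ^ n * ((2 * n : ℕ) * z ^ (2 * n - 1)) /
        (2 * (k + 1 - n : ℕ) + 1)) z :=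
    HasDerivAt.fun_sum fun n _ => ((hasDerivAt_pow (2 * n) z).const_mul _).div_const _
  have h2 : HasDerivAt (fun z : ℝ => (-4) ^ (k + 1) * ((k + 1).factorial : ℝ) ^ 2 /
      (2 * (k + 1) + 1).factorial * z ^ (2 * (k + 1) + 1)) _ z :=
    (hasDerivAt_pow (2 * (k + 1) + 1) z).const_mul _
  convert! h1.sub h2 using 1
  rw [coneIntegral, mul_sub]
  congr 1
  · rw [Finset.mul_sum, Finset.sum_range_succ' _ (k + 1)]
    simp only [mul_zero, Nat.cast_zero, zero_mul, zero_div, add_zero]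
    refine Finset.sum_congr rfl fun n _ => ?_
    have h3 : ((k + 1).choose (n + 1) : ℝ) * (n + 1) = (k + 1) * k.choose n := by
      exact_mod_cast (Nat.add_one_mul_choose_eq k n).symm
    rw [Nat.add_sub_add_right, show 2 * (n + 1) - 1 = 2 * n + 1 by omega]
    have h4 : (2 * ((k - n : ℕ) : ℝ) + 1) ≠ 0 := by positivity
    field_simp
    push_cast
    linear_combination (-2 * (-1) ^ n * z ^ (2 * n + 1)) * (-h3)
  · rw [show 2 * (k + 1) + 1 = 2 * k + 1 + 1 + 1 by ring, Nat.factorial_succ (2 * k + 1 + 1),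
      Nat.factorial_succ (2 * k + 1), Nat.factorial_succ k]
    simp only [Nat.add_sub_cancel]
    push_cast
    field_simp
    ring

lemma isMomentFamily_coneIntegral : IsMomentFamily 2 coneIntegral where
  continuous_zero := by unfold coneIntegral; fun_prop
  hasDerivAt_succ := hasDerivAt_coneIntegral_succ
  one k := coneIntegral_one (k + 1)
  nonneg_zero z hz := by simp [coneIntegral]; exact hz.2
  le_one k := by
    rw [coneIntegral, Finset.sum_eq_single 0 (fun n _ hn => by simp [hn]) (by simp)]
    simp only [pow_succ, mul_zero, sub_zero, Nat.choose_zero_right, pow_zero, Nat.sub_zero]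
    simp
    exact inv_le_one_of_one_le₀ (by linarith [(Nat.cast_nonneg k : (0 : ℝ) ≤ k)])
  le_one_zero z hz := by simp [coneIntegral]; exact hz.1
  moment_zero j := by
    have e : ∀ z : ℝ, z ^ (2 * j) * coneIntegral 0 z = z ^ (2 * j) - z ^ (2 * j + 1) := by
      intro z; simp [coneIntegral]; ring
    simp_rw [e]
    rw [intervalIntegral.integral_sub (Continuous.intervalIntegrable (by fun_prop) _ _)
      (Continuous.intervalIntegrable (by fun_prop) _ _), integral_pow, integral_pow,
      Nat.factorial_succ, Nat.factorial_succ]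
    have := (2 * j).factorial_ne_zero
    push_cast
    simp
    field_simp
    ring

/-- The sum is the polynomial behind ₃F₂; the leftover power of z feeds the cosine term of G. -/
lemma integral_coneIntegral (k : ℕ) (z : ℝ) :
    ∫ u in (0 : ℝ)..z, coneIntegral k u =
      z * ∑ n ∈ Finset.range (k + 1), k.choose n * (-1) ^ n * (z ^ 2) ^ n /
        ((2 * n + 1) * (2 * (k - n : ℕ) + 1))
      - (-4) ^ k * k.factorial ^ 2 / (2 * k + 2).factorial * z ^ (2 * k + 2) := by
  unfold coneIntegral
  rw [intervalIntegral.integral_sub (Continuous.intervalIntegrable (by fun_prop) _ _)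
      (Continuous.intervalIntegrable (by fun_prop) _ _), intervalIntegral.integral_finsetSum
    (fun n _ => Continuous.intervalIntegrable (by fun_prop) _ _), Finset.mul_sum]
  congr 1
  · refine Finset.sum_congr rfl fun n _ => ?_
    rw [intervalIntegral.integral_div, intervalIntegral.integral_const_mul, integral_pow, ← pow_mul]
    have h4 : (2 * ((k - n : ℕ) : ℝ) + 1) ≠ 0 := by positivity
    push_cast
    field_simp
    simp
    ring
  · rw [intervalIntegral.integral_const_mul, integral_pow, Nat.factorial_succ (2 * k + 1)]
    have := (2 * k + 1).factorial_ne_zero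
    push_cast
    field_simp
    simp

/-! ### Terminating hypergeometric series and convergence -/

/-- Both sides are the rising factorial of length n + 1. It collapses quotients (a)_n / (a+1)_n to a
/ (a+n), for a = 1/2 and a = -k - 1/2. -/
lemma mul_ascPochhammer_eval_add_one (a : ℝ) (n : ℕ) :
    a * (ascPochhammer ℝ n).eval (a + 1) = (ascPochhammer ℝ n).eval a * (a + n) := by
  rw [← ascPochhammer_succ_eval, ascPochhammer_succ_left]
  simp [Polynomial.eval_comp]

lemma ascPochhammer_eval_neg_natCast_div_factorial (k n : ℕ) :
    (ascPochhammer ℝ n).eval (-(k : ℝ)) / n.factorial = (-1) ^ n * k.choose n := by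
  have := n.factorial_ne_zero
  rw [ascPochhammer_eval_neg_eq_descPochhammer, descPochhammer_eval_eq_descFactorial,
    Nat.descFactorial_eq_factorial_mul_choose]
  push_cast
  field_simp

lemma ascPochhammer_half_div (n : ℕ) :
    (ascPochhammer ℝ n).eval (1 / 2 : ℝ) / (ascPochhammer ℝ n).eval (3 / 2 : ℝ) =
      1 / (2 * n + 1) := by
  have h := mul_ascPochhammer_eval_add_one (1 / 2) n
  rw [show (1 / 2 : ℝ) + 1 = 3 / 2 by norm_num] at h
  have h2 : 0 < (ascPochhammer ℝ n).eval (3 / 2 : ℝ) := ascPochhammer_pos n _ (by norm_num)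
  rw [div_eq_div_iff h2.ne' (by positivity)]
  linarith

lemma ascPochhammer_neg_half_div {k n : ℕ} (hn : n ≤ k) :
    (ascPochhammer ℝ n).eval (-(k : ℝ) - 1 / 2) / (ascPochhammer ℝ n).eval (-(k : ℝ) + 1 / 2) =
      (2 * k + 1) / (2 * (k - n : ℕ) + 1) := by
  have h := mul_ascPochhammer_eval_add_one (-(k : ℝ) - 1 / 2) n
  rw [show -(k : ℝ) - 1 / 2 + 1 = -(k : ℝ) + 1 / 2 by ring] at h
  have h2 : (ascPochhammer ℝ n).eval (-(k : ℝ) + 1 / 2) ≠ 0 := by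
    rw [Ne, ascPochhammer_eval_eq_zero_iff]
    rintro ⟨m, hm, h3⟩
    have : (m : ℝ) < k := by exact_mod_cast hm.trans_le hn
    have h4 : (m : ℝ) + 1 ≤ k := by exact_mod_cast hm.trans_le hn
    linarith
  rw [div_eq_div_iff h2 (by positivity), Nat.cast_sub hn]
  linarith

lemma ordinaryHypergeometric_neg_nat_half (k : ℕ) (w : ℝ) :
    ordinaryHypergeometric (-(k : ℝ)) (1 / 2 : ℝ) (3 / 2 : ℝ) w =
      ∑ n ∈ Finset.range (k + 1), k.choose n * (-1) ^ n * w ^ n / (2 * n + 1) := by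
  rw [ordinaryHypergeometric_eq_tsum]
  have e : ∀ n : ℕ, ((n.factorial : ℝ)⁻¹ * (ascPochhammer ℝ n).eval (-(k : ℝ)) *
      (ascPochhammer ℝ n).eval (1 / 2 : ℝ) * ((ascPochhammer ℝ n).eval (3 / 2 : ℝ))⁻¹) • w ^ n =
      k.choose n * (-1) ^ n * w ^ n / (2 * n + 1) := by
    intro n
    have h1 := ascPochhammer_eval_neg_natCast_div_factorial k n
    have h2 := ascPochhammer_half_div n
    rw [div_eq_mul_inv] at h1 h2
    rw [smul_eq_mul, mul_comm (n.factorial : ℝ)⁻¹, h1, mul_assoc, mul_assoc,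
      ← mul_assoc _ _ (w ^ n), h2]
    ring
  simp only [e]
  refine tsum_eq_sum fun n hn => ?_
  rw [Nat.choose_eq_zero_of_lt (by simpa using hn)]
  simp

lemma hypergeometric32_neg_nat (k : ℕ) (w : ℝ) :
    hypergeometric32 (-(k : ℝ)) (-(k : ℝ) - 1 / 2) (1 / 2) (-(k : ℝ) + 1 / 2) (3 / 2) w =
      (2 * k + 1) * ∑ n ∈ Finset.range (k + 1), k.choose n * (-1) ^ n * w ^ n /
        ((2 * n + 1) * (2 * (k - n : ℕ) + 1)) := by
  rw [hypergeometric32, tsum_eq_sum (s := Finset.range (k + 1)), Finset.mul_sum]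
  · refine Finset.sum_congr rfl fun n hn => ?_
    have h1 := ascPochhammer_eval_neg_natCast_div_factorial k n
    have h2 := ascPochhammer_half_div n
    have h3 := ascPochhammer_neg_half_div (Nat.lt_succ_iff.1 (Finset.mem_range.1 hn))
    simp only [risingFactorial]
    calc _ = ((ascPochhammer ℝ n).eval (-(k : ℝ)) / n.factorial) *
          ((ascPochhammer ℝ n).eval (-(k : ℝ) - 1 / 2) /
            (ascPochhammer ℝ n).eval (-(k : ℝ) + 1 / 2)) *
          ((ascPochhammer ℝ n).eval (1 / 2 : ℝ) / (ascPochhammer ℝ n).eval (3 / 2 : ℝ)) * w ^ n := by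
            simp only [div_eq_mul_inv, mul_inv]; ring
      _ = _ := by
        rw [h1, h2, h3]
        have h4 : (2 * ((k - n : ℕ) : ℝ) + 1) ≠ 0 := by positivity
        field_simp
  · intro n hn
    have h1 : (ascPochhammer ℝ n).eval (-(k : ℝ)) = 0 :=
      (ascPochhammer_eval_eq_zero_iff n _).2 ⟨k, by simpa using hn, by simp⟩
    simp [risingFactorial, h1]

/-- The crude bound 2^k is enough, since the prefactors decay like 1/(k!)². -/
lemma abs_sum_choose_mul_le {k : ℕ} {z : ℝ} (hz : |z| ≤ 1) {q : ℕ → ℝ} (hq : ∀ n, 1 ≤ q n) :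
    |∑ n ∈ Finset.range (k + 1), k.choose n * (-1) ^ n * (z ^ 2) ^ n / q n| ≤ 2 ^ k := by
  have h := Nat.sum_range_choose k
  have h' : ∑ n ∈ Finset.range (k + 1), (k.choose n : ℝ) = 2 ^ k := by exact_mod_cast h
  rw [← h']
  refine (Finset.abs_sum_le_sum_abs _ _).trans (Finset.sum_le_sum fun n _ => ?_)
  have h1 := hq n
  rw [abs_div, abs_mul, abs_mul, abs_pow, abs_pow, abs_pow, abs_neg, abs_one, one_pow, mul_one,
    Nat.abs_cast, abs_of_pos (by linarith : 0 < q n), div_le_iff₀ (by linarith)]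
  have h2 : (|z| ^ 2) ^ n ≤ 1 := pow_le_one₀ (by positivity) (pow_le_one₀ (abs_nonneg z) hz)
  calc (k.choose n : ℝ) * (|z| ^ 2) ^ n ≤ k.choose n * 1 := by gcongr
    _ ≤ k.choose n * q n := by gcongr

lemma summable_sq_factorial_mul (L M : ℝ) {u : ℕ → ℝ}
    (hu : ∀ k : ℕ, |u k| ≤ M * (L ^ (2 * k) / (k.factorial : ℝ) ^ 2 * 2 ^ k)) : Summable u := by
  have hM : 0 ≤ M := by simpa using (abs_nonneg _).trans (hu 0)
  refine Summable.of_norm_bounded ((Real.summable_pow_div_factorial (2 * L ^ 2)).mul_left M)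
    fun k => (hu k).trans ?_
  have h1 : (1 : ℝ) ≤ k.factorial := by exact_mod_cast k.factorial_pos
  rw [mul_pow, ← pow_mul, div_mul_eq_mul_div, mul_comm (L ^ (2 * k))]
  have h2 : (0 : ℝ) ≤ L ^ (2 * k) := by rw [pow_mul]; positivity
  gcongr
  nlinarith

lemma div_two_mul_sq (c t x : ℝ) : x ^ 2 / (4 * c ^ 2 * t ^ 2) = (x / (2 * c * t)) ^ 2 := by
  rw [div_pow]; ring_nf

lemma gaussTerm_eq (c lam x t : ℝ) (k : ℕ) :
    gaussTerm c lam x t k = (lam * t) ^ (2 * k) / (k.factorial : ℝ) ^ 2 *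
      (1 + lam * t / (2 * k + 2)) * ∑ n ∈ Finset.range (k + 1),
        k.choose n * (-1) ^ n * ((x / (2 * c * t)) ^ 2) ^ n / (2 * n + 1) := by
  rw [gaussTerm, ordinaryHypergeometric_neg_nat_half, div_two_mul_sq]

lemma threeTwoTerm_eq (c lam x t : ℝ) (k : ℕ) :
    threeTwoTerm c lam x t k = (lam * t) ^ (2 * k + 1) / (k.factorial : ℝ) ^ 2 *
      ∑ n ∈ Finset.range (k + 1), k.choose n * (-1) ^ n * ((x / (2 * c * t)) ^ 2) ^ n /
        ((2 * n + 1) * (2 * (k - n : ℕ) + 1)) := by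
  rw [threeTwoTerm, hypergeometric32_neg_nat, div_two_mul_sq]
  have : (2 * (k : ℝ) + 1) ≠ 0 := by positivity
  field_simp

lemma summable_gaussTerm {c lam x t : ℝ} (hL : 0 ≤ lam * t) (hx : |x / (2 * c * t)| ≤ 1) :
    Summable (gaussTerm c lam x t) := by
  refine summable_sq_factorial_mul (lam * t) (1 + lam * t) fun k => ?_
  rw [gaussTerm_eq, abs_mul, abs_mul, abs_of_nonneg (by positivity),
    abs_of_nonneg (a := 1 + lam * t / (2 * k + 2)) (by positivity)]
  have h1 := abs_sum_choose_mul_le (k := k) hx (q := fun n => 2 * (n : ℝ) + 1)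
    (fun n => by simp)
  have h2 : lam * t / (2 * k + 2) ≤ lam * t :=
    div_le_self hL (by linarith [(Nat.cast_nonneg k : (0 : ℝ) ≤ k)])
  calc _ ≤ (lam * t) ^ (2 * k) / (k.factorial : ℝ) ^ 2 * (1 + lam * t) * 2 ^ k := by gcongr
    _ = _ := by ring

lemma summable_threeTwoTerm {c lam x t : ℝ} (hL : 0 ≤ lam * t) (hx : |x / (2 * c * t)| ≤ 1) :
    Summable (threeTwoTerm c lam x t) := by
  refine summable_sq_factorial_mul (lam * t) (lam * t) fun k => ?_
  rw [threeTwoTerm_eq, abs_mul, abs_of_nonneg (by positivity)]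
  have h1 := abs_sum_choose_mul_le (k := k) hx
    (q := fun n => (2 * (n : ℝ) + 1) * (2 * (k - n : ℕ) + 1))
    (fun n => one_le_mul_of_one_le_of_one_le (by simp) (by simp))
  calc _ ≤ (lam * t) ^ (2 * k + 1) / (k.factorial : ℝ) ^ 2 * 2 ^ k := by gcongr
    _ = _ := by ring

/-! ### Densities and the explicit law -/

/-- The `k`-th term of the density on `(0, 1]` of the normalized sum of two telegraph processes,
up to the factor `exp (-2 * L)`. -/
noncomputable def telegraphSumDensity (L : ℝ) (k : ℕ) (z : ℝ) : ℝ :=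
  (L ^ (2 * k + 1) / (k.factorial : ℝ) ^ 2 + L ^ (2 * k + 2) / ((k + 1) * (k.factorial : ℝ) ^ 2) / 2)
    * (1 - z ^ 2) ^ k + L ^ (2 * k + 2) / (k.factorial : ℝ) ^ 2 * coneIntegral k z

lemma continuous_telegraphSumDensity (L : ℝ) (k : ℕ) : Continuous (telegraphSumDensity L k) := by
  have := isMomentFamily_coneIntegral.continuous k
  unfold telegraphSumDensity
  fun_prop

lemma telegraphSumDensity_nonneg {L : ℝ} (hL : 0 ≤ L) (k : ℕ) {z : ℝ} (hz : z ∈ Icc (0 : ℝ) 1) :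
    0 ≤ telegraphSumDensity L k z := by
  have h1 := isMomentFamily_coneIntegral.nonneg k z hz
  have h2 := isMomentFamily_one_sub_sq.nonneg k z hz
  unfold telegraphSumDensity
  positivity

lemma hasSum_integral_cos_telegraphSumDensity (L β : ℝ) :
    HasSum (fun k => ∫ z in (0 : ℝ)..1, Real.cos (β * z) * telegraphSumDensity L k z)
      (L * hypSeries 1 (4 * L ^ 2 - β ^ 2) + (hypSeries 0 (4 * L ^ 2 - β ^ 2) - Real.cos β) / 4
        + L ^ 2 * hypSeries 2 (4 * L ^ 2 - β ^ 2)) := by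
  have h1 := (isMomentFamily_one_sub_sq.hasSum_bessel_cos L β).mul_left L
  have h2 := (isMomentFamily_one_sub_sq.hasSum_bessel_succ_cos L β).div_const 2
  have h3 := (isMomentFamily_coneIntegral.hasSum_bessel_cos L β).mul_left (L ^ 2)
  rw [div_div, show (2 : ℝ) * 2 = 4 by norm_num] at h2
  refine ((h1.add h2).add h3).congr_fun fun k => ?_
  have hc := isMomentFamily_coneIntegral.continuous k
  have e : ∀ z, Real.cos (β * z) * telegraphSumDensity L k z =
      (L ^ (2 * k + 1) / (k.factorial : ℝ) ^ 2 +
        L ^ (2 * k + 2) / ((k + 1) * (k.factorial : ℝ) ^ 2) / 2) *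
        (Real.cos (β * z) * (1 - z ^ 2) ^ k) +
      L ^ (2 * k + 2) / (k.factorial : ℝ) ^ 2 * (Real.cos (β * z) * coneIntegral k z) := by
    intro z; unfold telegraphSumDensity; ring
  simp_rw [e]
  rw [intervalIntegral.integral_add (Continuous.intervalIntegrable (by fun_prop) _ _)
    (Continuous.intervalIntegrable (by fun_prop) _ _), intervalIntegral.integral_const_mul,
    intervalIntegral.integral_const_mul]
  ring

lemma hasSum_one_sub_cos (y : ℝ) :
    HasSum (fun k : ℕ => (-1) ^ k * y ^ (2 * k + 2) / (2 * k + 2).factorial) (1 - Real.cos y) := by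
  have h := ((hasSum_nat_add_iff' 1).2 (Real.hasSum_cos y)).neg
  simp at h
  refine h.congr_fun fun k => ?_
  rw [pow_succ (-1 : ℝ), show 2 * (k + 1) = 2 * k + 2 by ring]; ring

lemma hasSum_integral_telegraphSumDensity {c lam x t : ℝ} (hL : 0 ≤ lam * t)
    (hx : |x / (2 * c * t)| ≤ 1) :
    HasSum (fun k => ∫ z in (0 : ℝ)..(x / (2 * c * t)), telegraphSumDensity (lam * t) k z)
      (lam * t * (x / (2 * c * t)) * ((∑' k, gaussTerm c lam x t k) +
        ∑' k, threeTwoTerm c lam x t k) - (1 - Real.cos (2 * (lam * t) * (x / (2 * c * t)))) / 4) := by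
  have h1 := (((summable_gaussTerm hL hx).hasSum.add (summable_threeTwoTerm hL hx).hasSum).mul_left
    (lam * t * (x / (2 * c * t)))).sub
      ((hasSum_one_sub_cos (2 * (lam * t) * (x / (2 * c * t)))).div_const 4)
  refine h1.congr_fun fun k => ?_
  rw [gaussTerm_eq, threeTwoTerm_eq]
  set z := x / (2 * c * t)
  set L := lam * t
  have hc := isMomentFamily_coneIntegral.continuous k
  unfold telegraphSumDensity
  rw [intervalIntegral.integral_add (Continuous.intervalIntegrable (by fun_prop) _ _)
    (Continuous.intervalIntegrable (by fun_prop) _ _), intervalIntegral.integral_const_mul,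
    intervalIntegral.integral_const_mul, integral_one_sub_sq_pow, integral_coneIntegral]
  -- The leftover of `integral_coneIntegral`, weighted by L^(2k+2)/(k!)², is a quarter of the k-th
  -- term of 1 - cos(2Lz).
  have e : (-1 : ℝ) ^ k * (2 * L * z) ^ (2 * k + 2) / (2 * k + 2).factorial / 4 =
      L ^ (2 * k + 2) / (k.factorial : ℝ) ^ 2 *
        ((-4) ^ k * k.factorial ^ 2 / (2 * k + 2).factorial * z ^ (2 * k + 2)) := by
    rw [neg_pow (4 : ℝ), mul_pow, mul_pow, show (2 : ℝ) ^ (2 * k + 2) = 4 ^ k * 4 by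
      rw [pow_add, pow_mul]; norm_num]
    have := k.factorial_ne_zero
    field_simp
  rw [e]
  have e2 : L ^ (2 * k + 2) / ((k + 1) * (k.factorial : ℝ) ^ 2) / 2 =
      L ^ (2 * k + 2) / (k.factorial : ℝ) ^ 2 / (2 * k + 2) := by
    field_simp
  rw [e2]
  ring

/-- The absolutely continuous part, on `(0, 1]`, of the normalized sum of two telegraph
processes. -/
noncomputable def telegraphSumHalfAC (L : ℝ) : Measure ℝ :=
  Measure.sum fun k => (volume.restrict (Ioc 0 1)).withDensity
    fun z => ENNReal.ofReal (telegraphSumDensity L k z)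

/-- The law of the normalized sum of two telegraph processes is, up to the factor `exp (-2 * L)`,
the symmetrization of this measure. -/
noncomputable def telegraphSumHalf (L : ℝ) : Measure ℝ :=
  ENNReal.ofReal (1 / 4) • Measure.dirac 0 + ENNReal.ofReal (1 / 4) • Measure.dirac 1 +
    telegraphSumHalfAC L

/-- The law of the normalized sum of two telegraph processes. -/
noncomputable def telegraphSumLaw (L : ℝ) : Measure ℝ :=
  ENNReal.ofReal (Real.exp (-2 * L)) •
    (telegraphSumHalf L + (telegraphSumHalf L).map fun z => -z)

lemma hasSum_integral_telegraphSumDensity_one (L : ℝ) :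
    HasSum (fun k => ∫ z in (0 : ℝ)..1, telegraphSumDensity L k z) ((Real.exp (2 * L) - 1) / 2) := by
  have h := hasSum_integral_cos_telegraphSumDensity L 0
  simp only [zero_mul, Real.cos_zero, one_mul] at h
  convert h using 1
  -- At β = 0 the square is (cosh L + sinh L)² = exp(2L), which gives the total mass.
  have h1 := sq_hypSeries_add L (L ^ 2)
  rw [mul_hypSeries_one_sq, hypSeries_zero_sq, Real.cosh_add_sinh, ← Real.exp_nat_mul] at h1
  push_cast at h1
  rw [h1]
  ring_nf

/-- Equality up to null sets lets one statement serve open and closed half-lines and the whole line.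
-/
lemma telegraphSumHalfAC_apply {L : ℝ} (hL : 0 ≤ L) {A : Set ℝ} (hA : MeasurableSet A) {y h : ℝ}
    (hy : y ∈ Icc (0 : ℝ) 1) (hAy : (A ∩ Ioc 0 1 : Set ℝ) =ᵐ[volume] Ioc 0 y)
    (hh : HasSum (fun k => ∫ z in (0 : ℝ)..y, telegraphSumDensity L k z) h) :
    telegraphSumHalfAC L A = ENNReal.ofReal h := by
  have e : ∀ k, (volume.restrict (Ioc (0 : ℝ) 1)).withDensity
      (fun z => ENNReal.ofReal (telegraphSumDensity L k z)) A =
      ENNReal.ofReal (∫ z in (0 : ℝ)..y, telegraphSumDensity L k z) := by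
    intro k
    rw [withDensity_apply _ hA, Measure.restrict_restrict hA, setLIntegral_congr hAy,
      intervalIntegral.integral_of_le hy.1, ofReal_integral_eq_lintegral_ofReal]
    · exact ((continuous_telegraphSumDensity L k).intervalIntegrable 0 y).1
    · filter_upwards [ae_restrict_mem measurableSet_Ioc] with z hz
      exact telegraphSumDensity_nonneg hL k ⟨hz.1.le, hz.2.trans hy.2⟩
  rw [telegraphSumHalfAC, Measure.sum_apply _ hA, ← hh.tsum_eq,
    ENNReal.ofReal_tsum_of_nonneg (fun k => ?_) hh.summable]
  · simp only [e]
  · exact intervalIntegral.integral_nonneg hy.1 fun z hz =>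
      telegraphSumDensity_nonneg hL k ⟨hz.1, hz.2.trans hy.2⟩

lemma isFiniteMeasure_telegraphSumHalfAC {L : ℝ} (hL : 0 ≤ L) :
    IsFiniteMeasure (telegraphSumHalfAC L) := by
  refine ⟨?_⟩
  rw [telegraphSumHalfAC_apply hL MeasurableSet.univ (right_mem_Icc.2 zero_le_one)
    (by rw [univ_inter]; exact .rfl)
    (hasSum_integral_telegraphSumDensity_one L)]
  exact ENNReal.ofReal_lt_top

lemma isFiniteMeasure_telegraphSumHalf {L : ℝ} (hL : 0 ≤ L) :
    IsFiniteMeasure (telegraphSumHalf L) := by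
  have := isFiniteMeasure_telegraphSumHalfAC hL
  have h1 : IsFiniteMeasure (ENNReal.ofReal (1 / 4) • Measure.dirac (0 : ℝ)) :=
    Measure.smul_finite _ ENNReal.ofReal_ne_top
  have h2 : IsFiniteMeasure (ENNReal.ofReal (1 / 4) • Measure.dirac (1 : ℝ)) :=
    Measure.smul_finite _ ENNReal.ofReal_ne_top
  unfold telegraphSumHalf
  infer_instance

lemma isFiniteMeasure_telegraphSumLaw {L : ℝ} (hL : 0 ≤ L) :
    IsFiniteMeasure (telegraphSumLaw L) := by
  have := isFiniteMeasure_telegraphSumHalf hL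
  exact Measure.smul_finite _ ENNReal.ofReal_ne_top

/-! ### Distribution function of the explicit law -/

open Classical in
lemma telegraphSumHalf_real {L : ℝ} (hL : 0 ≤ L) {A : Set ℝ} (hA : MeasurableSet A) {y h : ℝ}
    (hy : y ∈ Icc (0 : ℝ) 1) (hAy : (A ∩ Ioc 0 1 : Set ℝ) =ᵐ[volume] Ioc 0 y)
    (hh : HasSum (fun k => ∫ z in (0 : ℝ)..y, telegraphSumDensity L k z) h) :
    (telegraphSumHalf L).real A =
      (if (0 : ℝ) ∈ A then 1 / 4 else 0) + (if (1 : ℝ) ∈ A then 1 / 4 else 0) + h := by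
  have hh0 : 0 ≤ h := hh.nonneg fun k => intervalIntegral.integral_nonneg hy.1 fun z hz =>
      telegraphSumDensity_nonneg hL k ⟨hz.1, hz.2.trans hy.2⟩
  have e : telegraphSumHalf L A = ENNReal.ofReal
      ((if (0 : ℝ) ∈ A then 1 / 4 else 0) + (if (1 : ℝ) ∈ A then 1 / 4 else 0) + h) := by
    rw [telegraphSumHalf, Measure.add_apply, Measure.add_apply, Measure.smul_apply,
      Measure.smul_apply, Measure.dirac_apply' _ hA, Measure.dirac_apply' _ hA,
      telegraphSumHalfAC_apply hL hA hy hAy hh, ENNReal.ofReal_add (by positivity) hh0,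
      ENNReal.ofReal_add (by positivity) (by positivity)]
    congr 2 <;> split_ifs with h0 <;> simp [h0]
  rw [measureReal_def, e, ENNReal.toReal_ofReal (by positivity)]

lemma telegraphSumHalf_real_univ {L : ℝ} (hL : 0 ≤ L) :
    (telegraphSumHalf L).real univ = Real.exp (2 * L) / 2 := by
  rw [telegraphSumHalf_real hL MeasurableSet.univ (right_mem_Icc.2 zero_le_one)
    (by rw [univ_inter]; exact .rfl)
    (hasSum_integral_telegraphSumDensity_one L)]
  simp
  ring

lemma telegraphSumHalf_real_Iio_of_nonpos {L : ℝ} (hL : 0 ≤ L) {z : ℝ} (hz : z ≤ 0) :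
    (telegraphSumHalf L).real (Iio z) = 0 := by
  have hA : Iio z ∩ Ioc 0 1 = Ioc (0 : ℝ) 0 := by
    ext u; simp; intro h1 h2; linarith
  rw [telegraphSumHalf_real hL measurableSet_Iio (left_mem_Icc.2 zero_le_one)
    (by rw [hA]; exact .rfl) (h := 0) (by simp)]
  simp [not_lt.2 hz, not_lt.2 (hz.trans zero_le_one)]

lemma telegraphSumHalf_real_Iio {L : ℝ} (hL : 0 ≤ L) {z h : ℝ} (hz : z ∈ Ioc (0 : ℝ) 1)
    (hh : HasSum (fun k => ∫ u in (0 : ℝ)..z, telegraphSumDensity L k u) h) :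
    (telegraphSumHalf L).real (Iio z) = 1 / 4 + h := by
  have hA : Iio z ∩ Ioc 0 1 = Ioo (0 : ℝ) z := by
    ext u; simp; have := hz.2; constructor
    · rintro ⟨h1, h2, h3⟩; exact ⟨h2, h1⟩
    · rintro ⟨h1, h2⟩; exact ⟨h2, h1, by linarith⟩
  rw [telegraphSumHalf_real hL measurableSet_Iio ⟨hz.1.le, hz.2⟩
    (by rw [hA]; exact Ioo_ae_eq_Ioc) hh]
  simp [hz.1, not_lt.2 hz.2]

lemma telegraphSumHalf_real_Iio_of_one_lt {L : ℝ} (hL : 0 ≤ L) {z : ℝ} (hz : 1 < z) :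
    (telegraphSumHalf L).real (Iio z) = Real.exp (2 * L) / 2 := by
  have hA : Iio z ∩ Ioc 0 1 = Ioc (0 : ℝ) 1 := by
    ext u; simp; intro h1 h2; linarith
  rw [telegraphSumHalf_real hL measurableSet_Iio (right_mem_Icc.2 zero_le_one)
    (by rw [hA]; exact .rfl) (hasSum_integral_telegraphSumDensity_one L)]
  simp [hz, zero_lt_one.trans hz]
  ring

lemma telegraphSumHalf_real_Iic_of_neg {L : ℝ} (hL : 0 ≤ L) {z : ℝ} (hz : z < 0) :
    (telegraphSumHalf L).real (Iic z) = 0 := by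
  have := isFiniteMeasure_telegraphSumHalf hL
  refine le_antisymm ?_ measureReal_nonneg
  rw [← telegraphSumHalf_real_Iio_of_nonpos hL le_rfl]
  exact measureReal_mono (Iic_subset_Iio.2 hz)

lemma telegraphSumHalf_real_Iic {L : ℝ} (hL : 0 ≤ L) {z h : ℝ} (hz : z ∈ Ico (0 : ℝ) 1)
    (hh : HasSum (fun k => ∫ u in (0 : ℝ)..z, telegraphSumDensity L k u) h) :
    (telegraphSumHalf L).real (Iic z) = 1 / 4 + h := by
  have hA : Iic z ∩ Ioc 0 1 = Ioc (0 : ℝ) z := by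
    ext u; simp; have := hz.2; constructor
    · rintro ⟨h1, h2, h3⟩; exact ⟨h2, h1⟩
    · rintro ⟨h1, h2⟩; exact ⟨h2, h1, by linarith⟩
  rw [telegraphSumHalf_real hL measurableSet_Iic ⟨hz.1, hz.2.le⟩ (by rw [hA]; exact .rfl) hh]
  simp [hz.1, not_le.2 hz.2]

lemma telegraphSumHalf_real_Iic_of_one_le {L : ℝ} (hL : 0 ≤ L) {z : ℝ} (hz : 1 ≤ z) :
    (telegraphSumHalf L).real (Iic z) = Real.exp (2 * L) / 2 := by
  have hA : Iic z ∩ Ioc 0 1 = Ioc (0 : ℝ) 1 := by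
    ext u; simp; intro h1 h2; linarith
  rw [telegraphSumHalf_real hL measurableSet_Iic (right_mem_Icc.2 zero_le_one)
    (by rw [hA]; exact .rfl) (hasSum_integral_telegraphSumDensity_one L)]
  simp [hz, zero_le_one.trans hz]
  ring

/-- Reflection turns `Iio z` into the complement of `Iic (-z)`; the atoms make the distinction
between `Iio` and `Iic` matter. -/
lemma telegraphSumLaw_real_Iio {L : ℝ} (hL : 0 ≤ L) (z : ℝ) :
    (telegraphSumLaw L).real (Iio z) = Real.exp (-2 * L) * ((telegraphSumHalf L).real (Iio z) +
      (Real.exp (2 * L) / 2 - (telegraphSumHalf L).real (Iic (-z)))) := by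
  have := isFiniteMeasure_telegraphSumHalf hL
  rw [telegraphSumLaw, measureReal_ennreal_smul_apply, ENNReal.toReal_ofReal (Real.exp_pos _).le,
    measureReal_add_apply, map_measureReal_apply measurable_neg measurableSet_Iio,
    ← telegraphSumHalf_real_univ hL, ← measureReal_compl measurableSet_Iic]
  congr 3
  ext u
  simp

/-! ### Characteristic function of the explicit law and conclusion -/

lemma integral_cos_telegraphSumHalf {L : ℝ} (hL : 0 ≤ L) (β : ℝ) :
    ∫ z, Real.cos (β * z) ∂(telegraphSumHalf L) =
      1 / 4 + Real.cos β / 4 + (L * hypSeries 1 (4 * L ^ 2 - β ^ 2) +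
        (hypSeries 0 (4 * L ^ 2 - β ^ 2) - Real.cos β) / 4
          + L ^ 2 * hypSeries 2 (4 * L ^ 2 - β ^ 2)) := by
  have hf := isFiniteMeasure_telegraphSumHalf hL
  have hi : Integrable (fun z => Real.cos (β * z)) (telegraphSumHalf L) :=
    (integrable_const (1 : ℝ)).mono' (Continuous.aestronglyMeasurable (by fun_prop))
      (ae_of_all _ fun z => by simpa using Real.abs_cos_le_one _)
  unfold telegraphSumHalf at hi ⊢
  rw [integrable_add_measure, integrable_add_measure] at hi
  rw [integral_add_measure (hi.1.1.add_measure hi.1.2) hi.2, integral_add_measure hi.1.1 hi.1.2,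
    integral_smul_measure, integral_smul_measure, integral_dirac, integral_dirac]
  congr 1
  · rw [ENNReal.toReal_ofReal (by norm_num)]
    simp
    ring
  · have h2 := hasSum_integral_measure (μ := fun k => (volume.restrict (Ioc 0 1)).withDensity
      fun z => ENNReal.ofReal (telegraphSumDensity L k z)) hi.2
    refine h2.unique ((hasSum_integral_cos_telegraphSumDensity L β).congr_fun fun k => ?_)
    rw [integral_withDensity_eq_integral_toReal_smul
      (continuous_telegraphSumDensity L k).measurable.ennreal_ofReal (by simp),
      intervalIntegral.integral_of_le zero_le_one]
    refine setIntegral_congr_fun measurableSet_Ioc fun z hz => ?_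
    rw [ENNReal.toReal_ofReal (telegraphSumDensity_nonneg hL k ⟨hz.1.le, hz.2⟩), smul_eq_mul,
      mul_comm]

/-- Symmetrization leaves twice the cosine integral of the half measure; the cos β from the atom at
1 cancels the one subtracted in the density part, and `sq_hypSeries_add` reassembles the square. -/
lemma charFun_telegraphSumLaw {L : ℝ} (hL : 0 ≤ L) (β : ℝ) :
    charFun (telegraphSumLaw L) β = (((Real.exp (-L) * (hypSeries 0 (L ^ 2 - β ^ 2 / 4)
      + L * hypSeries 1 (L ^ 2 - β ^ 2 / 4))) ^ 2 : ℝ) : ℂ) := by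
  have hf := isFiniteMeasure_telegraphSumHalf hL
  have hi : ∀ b : ℝ, Integrable (fun z : ℝ => Complex.exp (b * z * Complex.I))
      (telegraphSumHalf L) := fun b =>
    (integrable_const (1 : ℝ)).mono' (Continuous.aestronglyMeasurable (by fun_prop))
      (ae_of_all _ fun z => by
        rw [← Complex.ofReal_mul, Complex.norm_exp_ofReal_mul_I])
  have hneg : Measurable fun z : ℝ => -z := measurable_neg
  have hs : AEStronglyMeasurable (fun z : ℝ => Complex.exp (β * z * Complex.I))
      ((telegraphSumHalf L).map fun z => -z) := Continuous.aestronglyMeasurable (by fun_prop)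
  have hi2 : Integrable (fun z : ℝ => Complex.exp (β * z * Complex.I))
      ((telegraphSumHalf L).map fun z => -z) := by
    rw [integrable_map_measure hs hneg.aemeasurable]
    refine (hi (-β)).congr (ae_of_all _ fun z => ?_)
    simp
  rw [charFun_apply_real, telegraphSumLaw, integral_smul_measure, integral_add_measure (hi β) hi2,
    integral_map hneg.aemeasurable hs, ← integral_add (hi β)
      ((hi (-β)).congr (ae_of_all _ fun z => by simp))]
  have e : ∀ z : ℝ, Complex.exp (β * z * Complex.I) + Complex.exp (β * (-z : ℝ) * Complex.I) =
      ((2 * Real.cos (β * z) : ℝ) : ℂ) := by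
    intro z
    push_cast
    rw [Complex.two_cos]
    congr 2; ring
  simp_rw [e]
  rw [integral_complex_ofReal, integral_const_mul, integral_cos_telegraphSumHalf hL,
    ENNReal.toReal_ofReal (Real.exp_pos _).le, mul_pow, sq_hypSeries_add, ← Real.exp_nat_mul,
    Complex.real_smul, ← Complex.ofReal_mul]
  congr 1
  rw [show 4 * (L ^ 2 - β ^ 2 / 4) = 4 * L ^ 2 - β ^ 2 by ring]
  push_cast
  rw [show 2 * -L = -2 * L by ring]
  ring

section

variable {Ω : Type*} [MeasurableSpace Ω]

lemma map_telegraph_sum_eq {P : Measure Ω} [IsProbabilityMeasure P]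
    {c : ℝ} {lam : ℝ≥0} (hc : 0 < c) {X₁ X₂ : ℝ≥0 → Ω → ℝ}
    (hX₁ : IsTelegraphProcess c lam X₁ P) (hX₂ : IsTelegraphProcess c lam X₂ P)
    (hindep : IndepFun (fun ω t => X₁ t ω) (fun ω t => X₂ t ω) P) {t : ℝ≥0} (ht : 0 < t) :
    P.map (fun ω => (2 * c * t)⁻¹ * (X₁ t ω + X₂ t ω)) = telegraphSumLaw (lam * t) := by
  obtain ⟨m1, c1⟩ := hX₁.aemeasurable_and_charFun t
  obtain ⟨m2, c2⟩ := hX₂.aemeasurable_and_charFun t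
  have hL : (0 : ℝ) ≤ lam * t := by positivity
  have ht' : (0 : ℝ) < t := ht
  have hi : IndepFun (X₁ t) (X₂ t) P :=
    hindep.comp (φ := fun x : ℝ≥0 → ℝ => x t) (ψ := fun x : ℝ≥0 → ℝ => x t)
      (measurable_pi_apply t) (measurable_pi_apply t)
  have hm : AEMeasurable (fun ω => X₁ t ω + X₂ t ω) P := m1.add m2
  have := isFiniteMeasure_telegraphSumLaw hL
  have : IsProbabilityMeasure (P.map (fun ω => (2 * c * t)⁻¹ * (X₁ t ω + X₂ t ω))) :=
    Measure.isProbabilityMeasure_map (hm.const_mul _)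
  refine Measure.ext_of_charFun ?_
  funext β
  rw [charFun_map_mul_comp hm, hi.charFun_map_fun_add_eq_mul m1 m2, Pi.mul_apply, c1, c2,
    charFun_telegraphSumLaw hL, ← Complex.ofReal_mul]
  congr 1
  -- Frequency β of the normalized sum is frequency β/(2ct) of each process, whence the quarter of
  -- β².
  have e : (((lam : ℝ) ^ 2 - ((2 * c * t)⁻¹ * β * c) ^ 2) * (t : ℝ) ^ 2) =
      (lam * t) ^ 2 - β ^ 2 / 4 := by
    field_simp
    ring
  rw [e, neg_mul]
  ring

end

theorem theorem3 {Ω : Type*} [MeasurableSpace Ω] (P : Measure Ω) [IsProbabilityMeasure P]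
    (c : ℝ) (lam : ℝ≥0) (hc : 0 < c) (hlam : 0 < lam)
    (X₁ X₂ : ℝ≥0 → Ω → ℝ)
    (hX₁ : IsTelegraphProcess c lam X₁ P) (hX₂ : IsTelegraphProcess c lam X₂ P)
    (hindep : IndepFun (fun ω t => X₁ t ω) (fun ω t => X₂ t ω) P)
    (t : ℝ≥0) (ht : 0 < t) (x : ℝ) :
    (x ≤ -2 * c * t → P.real {ω | X₁ t ω + X₂ t ω < x} = 0) ∧
    (-2 * c * t < x → x ≤ 2 * c * t →
      Summable (gaussTerm c lam x t) ∧ Summable (threeTwoTerm c lam x t)) ∧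
    (-2 * c * t < x → x ≤ 0 →
      P.real {ω | X₁ t ω + X₂ t ω < x} = telegraphSumG (-1) c lam x t) ∧
    (0 < x → x ≤ 2 * c * t →
      P.real {ω | X₁ t ω + X₂ t ω < x} = telegraphSumG 1 c lam x t) ∧
    (2 * c * t < x → P.real {ω | X₁ t ω + X₂ t ω < x} = 1) := by
  have hL : (0 : ℝ) ≤ lam * t := by positivity
  have ht' : (0 : ℝ) < t := ht
  have hr : 0 < 2 * c * t := by positivity
  have hm : AEMeasurable (fun ω => (2 * c * t)⁻¹ * (X₁ t ω + X₂ t ω)) P :=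
    ((hX₁.aemeasurable_and_charFun t).1.add (hX₂.aemeasurable_and_charFun t).1).const_mul _
  set L : ℝ := lam * t with hLdef
  set z : ℝ := x / (2 * c * t) with hz
  have hP : P.real {ω | X₁ t ω + X₂ t ω < x} = Real.exp (-2 * L) *
      ((telegraphSumHalf L).real (Iio z) +
        (Real.exp (2 * L) / 2 - (telegraphSumHalf L).real (Iic (-z)))) := by
    rw [← telegraphSumLaw_real_Iio hL, hLdef, ← map_telegraph_sum_eq hc hX₁ hX₂ hindep ht,
      measureReal_def, measureReal_def, Measure.map_apply_of_aemeasurable hm measurableSet_Iio]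
    congr 2
    ext ω
    simp only [mem_ofPred_eq, mem_preimage, mem_Iio, hz]
    rw [lt_div_iff₀ hr, mul_comm, mul_inv_cancel_left₀ hr.ne']
  have hexp : Real.exp (-2 * L) * Real.exp (2 * L) = 1 := by
    rw [← Real.exp_add]; simp
  have habs : -2 * c * t < x → x ≤ 2 * c * t → |x / (2 * c * t)| ≤ 1 := by
    intro h1 h2
    rw [abs_le, le_div_iff₀ hr, div_le_iff₀ hr]
    constructor <;> linarith
  have hcos : Real.cos (2 * L * z) = Real.cos (lam * x / c) := by
    congr 1; rw [hz, hLdef]; field_simp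
  have hLz : L * z = lam * x / (2 * c) := by
    rw [hz, hLdef]; field_simp
  have hGexp : Real.exp (-2 * lam * t) = Real.exp (-2 * L) := by
    rw [hLdef, mul_assoc]
  refine ⟨fun h1 => ?_, fun h1 h2 => ⟨summable_gaussTerm hL (habs h1 h2),
    summable_threeTwoTerm hL (habs h1 h2)⟩, fun h1 h2 => ?_, fun h1 h2 => ?_, fun h1 => ?_⟩
  · have hz1 : z ≤ -1 := by rw [hz, div_le_iff₀ hr]; linarith
    rw [hP, telegraphSumHalf_real_Iio_of_nonpos hL (by linarith),
      telegraphSumHalf_real_Iic_of_one_le hL (by linarith)]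
    ring
  · have hz1 : -1 < z := by rw [hz, lt_div_iff₀ hr]; linarith
    have hz2 : z ≤ 0 := div_nonpos_of_nonpos_of_nonneg h2 hr.le
    -- For x ≤ 0 only the reflected half contributes, evaluated at -z; the hypergeometric terms are
    -- even in x.
    have hs := hasSum_integral_telegraphSumDensity (c := c) (lam := lam) (x := -x) (t := t) hL
      (by rw [neg_div, abs_neg]; exact habs h1 (by linarith))
    have e1 : gaussTerm c lam (-x) t = gaussTerm c lam x t := by
      funext k; simp [gaussTerm]
    have e2 : threeTwoTerm c lam (-x) t = threeTwoTerm c lam x t := by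
      funext k; simp [threeTwoTerm]
    rw [e1, e2, neg_div, ← hz, ← hLdef, mul_neg (2 * L), Real.cos_neg, hcos] at hs
    rw [hP, telegraphSumHalf_real_Iio_of_nonpos hL hz2,
      telegraphSumHalf_real_Iic hL ⟨by linarith, by linarith⟩ hs, telegraphSumG, hGexp,
      mul_div_right_comm (lam * x : ℝ), ← hLz]
    linear_combination hexp / 2
  · have hz1 : z ≤ 1 := by rw [hz, div_le_iff₀ hr]; linarith
    have hz2 : 0 < z := div_pos h1 hr
    have hs := hasSum_integral_telegraphSumDensity (c := c) (lam := lam) (x := x) (t := t) hL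
      (habs (by linarith) h2)
    rw [← hz, ← hLdef, hcos] at hs
    rw [hP, telegraphSumHalf_real_Iio hL ⟨hz2, hz1⟩ hs,
      telegraphSumHalf_real_Iic_of_neg hL (by linarith), telegraphSumG, hGexp,
      mul_div_right_comm (lam * x : ℝ), ← hLz]
    linear_combination hexp / 2
  · have hz1 : 1 < z := by rw [hz, lt_div_iff₀ hr]; linarith
    rw [hP, telegraphSumHalf_real_Iio_of_one_lt hL hz1,
      telegraphSumHalf_real_Iic_of_neg hL (by linarith)]
    linear_combination hexp
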